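/- Theorem. Let $G$ be a finite graph, possibly with parallel edges but without loops. Let $F\subseteq E(G)$ be (the edge set of) an arbitrary forest, let $e_1<e_2<\dots<e_h$ be an ordering of the edges not in $F$, and fix an orientation $e_i=\overrightarrow{u_iv_i}$ of each of them. Notation. Let $H$ be a connected subgraph of $G$. A divisor on $H$ is a function $D:V(H)\to\mathbb Z$; $(q)$ denotes the divisor with value $1$ at $q$ and $0$ elsewhere. $D$ is a *break divisor* of $H$ if for some spanning tree $T$ of $H$ and some orientation of the edges of $H$ not in $T$, $D$ is the sum of the divisors $(x)$ over the heads $x$ of these edges. For an orientation $\mathcal O$ of $H$ put $D_{\mathcal O}=\sum_{x\in V(H)}(\operatorname{indeg}_{\mathcal O}(x)-1)(x)$. Edge ordering map. For a spanning tree $T$ of $H$ and an edge $f$ of $H$ not in $T$, let $C$ be the unique cycle in $T+f$, direct $C$ so that its smallest edge $e_i$ is traversed from $u_i$ to $v_i$, and orient $f$ as it is traversed in $C$. The edge ordering map sends $T$ to the sum of $(\text{head of }f)$ over all edges $f$ of $H$ not in $T$. Subroutine. Let $\mathrm{DTO}$ be any subroutine which, given a connected subgraph $H$ of $G$, a break divisor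 $D$ of $H$ and a vertex $q$ of $H$, outputs an orientation $\mathcal O$ of $H$ with $D=D_{\mathcal O}+(q)$. Inverse algorithm $\mathrm{Inv}(H,D)$. If $D=0$, output the edge set $E(H)$. Otherwise let $e_i$ be the smallest of the edges $e_1,\dots,e_h$ lying in $H$, let $\mathcal O=\mathrm{DTO}(H,D,v_i)$, and let $U$ be the set of vertices reachable from $u_i$ by directed paths of $\mathcal O$. - If $v_i\in U$, output $\mathrm{Inv}(H-e_i,\,D-(v_i))$. - If $v_i\notin U$, put $U^c=V(H)\setminus U$, let $D_R$ be the restriction of $D$ to $U^c$, and let $D_L$ be obtained from the restriction of $D$ to $U$ by subtracting $(x)$ for every edge $f\ne e_i$ of $H$ directed in $\mathcal O$ from a vertex of $U^c$ to a vertex $x\in U$. Output $\{e_i\}\cup\mathrm{Inv}(H[U],D_L)\cup\mathrm{Inv}(H[U^c],D_R)$. Claim. 1. A subroutine $\mathrm{DTO}$ as above exists. 2. For every such subroutine and every connected subgraph $H$ of $G$ (in particular $H=G$ if $G$ is connected): for every break divisor $D$ of $H$ the algorithm $\mathrm{Inv}(H,D)$ terminates, and its output is a spanning tree of $H$ which the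 edge ordering map sends to $D$; and for every spanning tree $T$ of $H$, the edge ordering map sends $T$ to a break divisor $D$ of $H$ and $\mathrm{Inv}(H,D)$ terminates with output $T$. 3. Consequently, for every connected subgraph $H$ of $G$, the edge ordering map is a bijection from the spanning trees of $H$ onto the break divisors of $H$. -/

import Mathlib

open scoped Graph

namespace EdgeOrdering

section Graphs

variable {V E : Type*}

/-- A graph is connected if it has a vertex and any two of its vertices are joined by a walk. -/
def Connected (G : Graph V E) : Prop :=
  V(G).Nonempty ∧ ∀ x ∈ V(G), ∀ y ∈ V(G), Relation.ReflTransGen G.Adj x y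

/-- A (simple) cycle of `G` together with a direction of traversal: the cyclically indexed
vertices are distinct, the edges are distinct, and `edge j` is traversed from `vert j` to
`vert (j + 1)`. In a loopless graph the length is at least two, and a pair of parallel edges
gives a cycle of length two. -/
structure DirectedCycle (G : Graph V E) where
  len : ℕ
  len_pos : 0 < len
  vert : ZMod len → V
  edge : ZMod len → E
  vert_injective : Function.Injective vert
  edge_injective : Function.Injective edge
  isLink : ∀ j, G.IsLink (edge j) (vert j) (vert (j + 1))

/-- `F` is the edge set of a forest of `G`. -/
def IsForest (G : Graph V E) (F : Set E) : Prop :=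
  F ⊆ E(G) ∧ IsEmpty (DirectedCycle (G.restrict F))

/-- `T` is the edge set of a spanning tree of `G`: the spanning subgraph with edge set `T` is
connected and has no cycle. -/
def IsSpanningTree (G : Graph V E) (T : Set E) : Prop :=
  T ⊆ E(G) ∧ Connected (G.restrict T) ∧ IsEmpty (DirectedCycle (G.restrict T))

/-- The divisor `(q)`: one chip at `q`. -/
noncomputable def chip (q : V) : V → ℤ := Set.indicator {q} 1

/-- `D` is a break divisor of `G`: for some spanning tree `T` and some choice of a head `η f`
among the ends of every edge `f` outside `T`, there are `#{f ∉ T : η f = x}` chips at each `x`.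
(A divisor on `G` is a function on the ambient type that vanishes outside `V(G)`.) -/
def IsBreakDivisor (G : Graph V E) (D : V → ℤ) : Prop :=
  ∃ T, IsSpanningTree G T ∧ ∃ η : E → V, (∀ f ∈ E(G) \ T, G.Inc f (η f)) ∧
    ∀ x, D x = ({f | f ∈ E(G) \ T ∧ η f = x}.ncard : ℤ)

/-- An orientation of a loopless graph, given by the head `O f` of every edge `f`. -/
def IsOrientation (G : Graph V E) (O : E → V) : Prop :=
  ∀ f ∈ E(G), G.Inc f (O f)

/-- The divisor `D_O = ∑ₓ (indeg x - 1) (x)` of an orientation `O` of `G`. -/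
noncomputable def orientationDivisor (G : Graph V E) (O : E → V) : V → ℤ :=
  V(G).indicator fun x => ({f | f ∈ E(G) ∧ O f = x}.ncard : ℤ) - 1

/-- The vertices that can be reached from `x` along a directed path of the orientation `O`. -/
def reachable (G : Graph V E) (O : E → V) (x : V) : Set V :=
  {y | Relation.ReflTransGen (fun a b => ∃ f, G.IsLink f a b ∧ O f = b) x y}

/-- The input of the edge ordering map: a forest of `G`, an ordering `e 0 < e 1 < ⋯` of the edges
outside the forest, and a reference orientation `u i → v i` of each `e i`. -/
structure EdgeOrder (G : Graph V E) where
  forest : Set E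
  isForest : IsForest G forest
  h : ℕ
  e : Fin h → E
  e_injective : Function.Injective e
  range_e : Set.range e = E(G) \ forest
  u : Fin h → V
  v : Fin h → V
  isLink : ∀ i, G.IsLink (e i) (u i) (v i)

variable {G : Graph V E}

/-- `i` is the index of the smallest edge in `S`. -/
def EdgeOrder.IsSmallest (data : EdgeOrder G) (S : Set E) (i : Fin data.h) : Prop :=
  IsLeast {j | data.e j ∈ S} i

/-- For a spanning tree `T` of `H` and an edge `f` of `H` outside `T`, the edge ordering map orients
`f` with head `x`: the cycle `C` in `T + f`, directed so that its smallest edge `e i` is traversed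
from `u i` to `v i`, traverses `f` towards `x`. -/
def EdgeOrder.Orients (data : EdgeOrder G) (H : Graph V E) (T : Set E) (f : E) (x : V) : Prop :=
  ∃ C : DirectedCycle (H.restrict (insert f T)),
    (∃ i, data.IsSmallest (Set.range C.edge) i ∧
      ∃ j, C.edge j = data.e i ∧ C.vert j = data.u i ∧ C.vert (j + 1) = data.v i) ∧
    ∃ k, C.edge k = f ∧ C.vert (k + 1) = x

/-- The edge ordering map on the spanning trees of `H`: one chip at the head of each edge outside
`T`. -/
noncomputable def EdgeOrder.edgeOrderingMap (data : EdgeOrder G) (H : Graph V E) (T : Set E) :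
    V → ℤ :=
  fun x => ({f | f ∈ E(H) \ T ∧ data.Orients H T f x}.ncard : ℤ)

/-- `sub` is a correct divisor-to-orientation subroutine on the connected subgraphs of `G`: given
a connected `H ≤ G`, a break divisor `D` of `H` and a vertex `q` of `H`, it outputs an orientation
`O` of `H` with `D = D_O + (q)`. Its behaviour on other inputs is arbitrary. -/
def IsDivisorToOrientation (G : Graph V E) (sub : Graph V E → (V → ℤ) → V → (E → V)) : Prop :=
  ∀ H ≤ G, Connected H → ∀ D, IsBreakDivisor H D → ∀ q ∈ V(H),
    IsOrientation H (sub H D q) ∧ D = orientationDivisor H (sub H D q) + chip q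

open Classical in
/-- The recursive inverse algorithm with subroutine `sub`, run on `(H, D)` with recursion depth
limited by the first argument. The value is `none` if the limit is exceeded or if the algorithm
gets stuck because `D ≠ 0` and `H` contains none of the ordered edges. -/
noncomputable def EdgeOrder.inverse (data : EdgeOrder G)
    (sub : Graph V E → (V → ℤ) → V → (E → V)) :
    ℕ → Graph V E → (V → ℤ) → Option (Set E)
  | 0, _, _ => none
  | n + 1, H, D =>
    if D = 0 then some E(H)
    else if hi : ∃ i, data.IsSmallest E(H) i then
      let i := hi.choose
      let O := sub H D (data.v i)
      let U := reachable H O (data.u i)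
      if data.v i ∈ U then
        data.inverse sub n (H.deleteEdges {data.e i}) (D - chip (data.v i))
      else
        -- one chip is removed at `x` for each edge other than `e i` directed into `x` from outside `U`
        let DL : V → ℤ := U.indicator fun x =>
          D x - ({f | f ≠ data.e i ∧ ∃ w ∉ U, H.IsLink f w x ∧ O f = x}.ncard : ℤ)
        let DR : V → ℤ := (V(H) \ U).indicator D
        (data.inverse sub n (H.induce U) DL).bind fun TL =>
          (data.inverse sub n (H.induce (V(H) \ U)) DR).map fun TR =>
            {data.e i} ∪ TL ∪ TR
    else none

/-- The inverse algorithm terminates on `(H, D)` with output `T`: for every sufficiently large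
recursion depth it returns `T`. -/
def EdgeOrder.Outputs (data : EdgeOrder G) (sub : Graph V E → (V → ℤ) → V → (E → V))
    (H : Graph V E) (D : V → ℤ) (T : Set E) : Prop :=
  ∃ N, ∀ n ≥ N, data.inverse sub n H D = some T

end Graphs

end EdgeOrdering

/-! Break divisors are rooted orientations in disguise: for any vertex `q`, `D` is a break divisor
exactly when `D = D_O + (q)` for some orientation `O` in which `q` reaches every vertex. Orienting a
spanning tree away from `q` gives every other vertex one incoming tree edge, which cancels its `-1`;
conversely, shortest directed paths from `q` supply such a tree. The set reachable from a vertex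
depends only on `D_O` (`reachable_eq_of_orientationDivisor_eq`), so the choice made by the
subroutine is irrelevant.

Every cycle contains an ordered edge, since the others form a forest; hence heads are well defined.
Let `e = uv` be the smallest edge of `H`. If `e` is outside `T`, its head is `v`, and deleting it
changes no other head. If `e` is in `T`, it defines a cut with side `X` containing `u`. Every other
edge crossing the cut has `e` on its cycle and so is oriented against `e`, into `X`. With `T`
directed away from `v`, `e` enters `X` as well, so `X` is exactly what `u` reaches
(`reachable_eq_of_cut`). Reachability of `v` from `u` thus decides whether `e` lies in `T`, and the
reachable set reveals the cut.

Two inductions on the number of edges finish the proof. `exists_edgeOrderingMap_eq` splits a break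
divisor along this dichotomy and glues trees of the pieces, giving surjectivity.
`outputs_edgeOrderingMap` shows that the algorithm recovers `T` from its image, giving injectivity
and correctness. -/

namespace EdgeOrdering

variable {V E : Type*} {G H K : Graph V E}

/-! ### Directed cycles and how they cross vertex sets -/

namespace DirectedCycle

/-- A cycle whose edges and vertices all lie in another graph. -/
def transfer (C : DirectedCycle H)
    (h : ∀ j, K.IsLink (C.edge j) (C.vert j) (C.vert (j + 1))) : DirectedCycle K :=
  { C with isLink := h }

/-- The cycle traversed backwards. -/
def reverse (C : DirectedCycle H) : DirectedCycle H where
  len := C.len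
  len_pos := C.len_pos
  vert j := C.vert (-j)
  edge j := C.edge (-j - 1)
  vert_injective _ _ h := neg_injective (C.vert_injective h)
  edge_injective _ _ h := neg_injective (sub_left_injective (C.edge_injective h))
  isLink j := by
    have := (C.isLink (-j - 1)).symm
    rw [sub_add_cancel] at this
    rwa [show -(j + 1) = -j - 1 by ring]

theorem exists_reverse_eq (C : DirectedCycle H) (l : ZMod C.len) :
    ∃ l', C.reverse.edge l' = C.edge l ∧ C.reverse.vert l' = C.vert (l + 1) ∧
      C.reverse.vert (l' + 1) = C.vert l := by
  refine ⟨(-l - 1 : ZMod C.len), congrArg C.edge ?_, congrArg C.vert ?_, congrArg C.vert ?_⟩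
  · ring
  · ring
  · change -(-l - 1 + 1) = l
    ring

theorem range_reverse_edge (C : DirectedCycle H) :
    Set.range C.reverse.edge = Set.range C.edge := by
  ext g
  constructor
  · rintro ⟨l, rfl⟩
    exact ⟨_, rfl⟩
  · rintro ⟨l, rfl⟩
    obtain ⟨l', h, -⟩ := C.exists_reverse_eq l
    exact ⟨l', h⟩

/-- A cycle that leaves a vertex set has to enter it again, along a different edge. -/
theorem exists_enter (C : DirectedCycle H) {X : Set V} {j : ZMod C.len}
    (hj : C.vert j ∈ X) (hj' : C.vert (j + 1) ∉ X) :
    ∃ k, C.edge k ≠ C.edge j ∧ C.vert k ∉ X ∧ C.vert (k + 1) ∈ X := by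
  classical
  have : NeZero C.len := ⟨C.len_pos.ne'⟩
  -- The increments of the indicator of `X` around the cycle sum to zero, so the decrease at `j`
  -- forces an increase elsewhere.
  let g : ZMod C.len → ℤ := fun k => if C.vert k ∈ X then 1 else 0
  have hsum : ∑ k, (g (k + 1) - g k) = 0 := by
    rw [Finset.sum_sub_distrib, sub_eq_zero]
    exact Equiv.sum_comp (Equiv.addRight (1 : ZMod C.len)) g
  obtain ⟨k, -, hk⟩ := Finset.exists_pos_of_sum_zero_of_exists_nonzero _ hsum
    ⟨j, Finset.mem_univ _, by simp [g, hj, hj']⟩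
  have hk1 : C.vert (k + 1) ∈ X := by
    by_contra h
    simp only [g, h, if_false] at hk
    split_ifs at hk <;> simp at hk
  have hk0 : C.vert k ∉ X := by
    intro h
    simp [g, h, hk1] at hk
  exact ⟨k, fun h => hk0 (C.edge_injective h ▸ hj), hk0, hk1⟩

/-- A cycle that enters a vertex set has to leave it again, along a different edge. -/
theorem exists_leave (C : DirectedCycle H) {X : Set V} {j : ZMod C.len}
    (hj : C.vert j ∉ X) (hj' : C.vert (j + 1) ∈ X) :
    ∃ k, C.edge k ≠ C.edge j ∧ C.vert k ∈ X ∧ C.vert (k + 1) ∉ X := by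
  obtain ⟨k, h1, h2, h3⟩ := C.exists_enter (X := Xᶜ) (j := j) hj (by simpa using hj')
  exact ⟨k, h1, by simpa using h2, h3⟩

/-- If an edge of a cycle crosses a vertex set, so does another one. -/
theorem exists_ne_crossing (C : DirectedCycle H) {X : Set V} {j : ZMod C.len}
    (hj : ¬ (C.vert j ∈ X ↔ C.vert (j + 1) ∈ X)) :
    ∃ k, C.edge k ≠ C.edge j ∧ ¬ (C.vert k ∈ X ↔ C.vert (k + 1) ∈ X) := by
  by_cases h : C.vert j ∈ X
  · obtain ⟨k, h1, h2, h3⟩ := C.exists_enter h (by tauto)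
    exact ⟨k, h1, by tauto⟩
  · obtain ⟨k, h1, h2, h3⟩ := C.exists_leave h (by tauto)
    exact ⟨k, h1, by tauto⟩

/-- A cycle none of whose edges crosses `X` lies inside or outside `X`. -/
theorem vert_mem_iff (C : DirectedCycle H) {X : Set V}
    (h : ∀ j, C.vert j ∈ X ↔ C.vert (j + 1) ∈ X) (j k : ZMod C.len) :
    C.vert j ∈ X ↔ C.vert k ∈ X := by
  have : NeZero C.len := ⟨C.len_pos.ne'⟩
  have key : ∀ n : ℕ, C.vert 0 ∈ X ↔ C.vert n ∈ X := by
    intro n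
    induction n with
    | zero => simp
    | succ n ih => rw [ih, h]; push_cast; rfl
  have := key j.val
  have := key k.val
  simp only [ZMod.natCast_zmod_val] at *
  tauto

end DirectedCycle

/-! ### Spanning trees, their cycles and cuts -/

/-- A walk between the ends of an edge `e` that does not use `e` gives a cycle through `e`. -/
theorem exists_directedCycle (hle : K ≤ H) {a b : V} {e : E}
    (hab : Relation.ReflTransGen K.Adj a b) (he : H.IsLink e b a) (heK : e ∉ E(K)) :
    ∃ C : DirectedCycle H, ∃ j, C.edge j = e := by
  classical
  -- A simple graph is used only to shorten the walk to a path; edges of `K` are chosen again along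
  -- it.
  let S : SimpleGraph V := SimpleGraph.fromRel K.Adj
  have hreach : S.Reachable a b := by
    clear he
    induction hab with
    | refl => rfl
    | @tail x y _ hxy ih =>
      refine ih.trans ?_
      by_cases h : x = y
      · rw [h]
      · exact SimpleGraph.Adj.reachable ((SimpleGraph.fromRel_adj _ _ _).2 ⟨h, .inl hxy⟩)
  obtain ⟨p, hp⟩ := hreach.exists_isPath
  have hinj := hp.getVert_injOn
  have hadj : ∀ i, i < p.length → ∃ f, K.IsLink f (p.getVert i) (p.getVert (i + 1)) := by
    intro i hi
    obtain ⟨-, h | h⟩ := (SimpleGraph.fromRel_adj _ _ _).1 (p.adj_getVert_succ hi)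
    · exact h
    · exact h.symm
  have : Nonempty E := ⟨e⟩
  choose! g hg using hadj
  let n := p.length
  have hval : ∀ j : ZMod (n + 1), j.val ≤ n := fun j => Nat.lt_succ_iff.1 (ZMod.val_lt j)
  have hsucc : ∀ j : ZMod (n + 1), j.val < n → (j + 1).val = j.val + 1 := by
    intro j hj
    have hn : (1 : ZMod (n + 1)).val = 1 := by
      rw [ZMod.val_one_eq_one_mod, Nat.mod_eq_of_lt (by omega)]
    rw [ZMod.val_add_of_lt (by omega), hn]
  have hlast : ∀ j : ZMod (n + 1), ¬ j.val < n → (j + 1).val = 0 := by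
    intro j hj
    have : j.val = n := le_antisymm (hval j) (not_lt.1 hj)
    have hj' : j = (n : ZMod (n + 1)) := by
      conv_lhs => rw [← ZMod.natCast_zmod_val j]
      exact congrArg _ this
    rw [hj']
    have : ((n : ZMod (n + 1)) + 1) = ((n + 1 : ℕ) : ZMod (n + 1)) := by push_cast; rfl
    rw [this, ZMod.natCast_self, ZMod.val_zero]
  have hvert : ∀ j k : ZMod (n + 1), p.getVert j.val = p.getVert k.val → j = k :=
    fun j k h => ZMod.val_injective _ (hinj (hval j) (hval k) h)
  -- The `n` path edges sit at indices below `n`; `e` sits at index `n` and closes the cycle back to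
  -- index `0`.
  refine ⟨{ len := n + 1
            len_pos := n.succ_pos
            vert := fun j => p.getVert j.val
            edge := fun j => if j.val < n then g j.val else e
            vert_injective := fun j k h => hvert j k h
            edge_injective := ?_
            isLink := ?_ }, (n : ZMod (n + 1)), ?_⟩
  · intro j k h
    dsimp only at h
    split_ifs at h with hj hk hk
    · have h1 := hg _ hj
      have h2 := hg _ hk
      rw [h] at h1
      obtain ⟨h3, -⟩ | ⟨h3, h4⟩ := h1.eq_and_eq_or_eq_and_eq h2
      · exact hvert _ _ h3
      · have h3 := hinj (hval j) (show k.val + 1 ≤ n by omega) h3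
        have h4 := hinj (show j.val + 1 ≤ n by omega) (hval k) h4
        omega
    · exact absurd (h ▸ (hg _ hj).edge_mem) heK
    · exact absurd (h ▸ (hg _ hk).edge_mem) heK
    · refine ZMod.val_injective _ ?_
      have := hval j
      have := hval k
      omega
  · intro j
    split_ifs with hj
    · rw [hsucc j hj]
      exact (hg _ hj).mono hle
    · rw [hlast j hj, le_antisymm (hval j) (not_lt.1 hj)]
      simpa [n] using he
  · have : ((n : ZMod (n + 1))).val = n := by
      rw [ZMod.val_natCast, Nat.mod_eq_of_lt n.lt_succ_self]
    simp [this]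

theorem reflTransGen_adj_symm (H : Graph V E) {a b : V} (h : Relation.ReflTransGen H.Adj a b) :
    Relation.ReflTransGen H.Adj b a := by
  induction h with
  | refl => exact .refl
  | tail _ h ih => exact .head h.symm ih

/-- To check connectedness, it is enough to reach every vertex from one of them. -/
theorem connected_of_root {q : V} (hq : q ∈ V(H))
    (h : ∀ x ∈ V(H), Relation.ReflTransGen H.Adj q x) : Connected H :=
  ⟨⟨q, hq⟩, fun x hx y hy => (reflTransGen_adj_symm H (h x hx)).trans (h y hy)⟩

theorem IsSpanningTree.connected {T : Set E} (hT : IsSpanningTree H T) : Connected H := by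
  refine ⟨hT.2.1.1, fun x hx y hy => ?_⟩
  exact (hT.2.1.2 x hx y hy).lift id fun a b h => Graph.Adj.mono Graph.restrict_le h

/-- Adding an edge to a spanning tree produces a cycle through that edge. -/
theorem IsSpanningTree.exists_directedCycle {T : Set E} (hT : IsSpanningTree H T) {f : E}
    (hf : f ∈ E(H) \ T) :
    ∃ C : DirectedCycle (H.restrict (insert f T)), ∃ j, C.edge j = f := by
  obtain ⟨x, y, h⟩ := Graph.exists_isLink_of_mem_edgeSet hf.1
  refine EdgeOrdering.exists_directedCycle
    (H.restrict_mono_right (Set.subset_insert f T)) (hT.2.1.2 y h.right_mem x h.left_mem)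
    (by simpa using h) ?_
  simp [hf.2]

/-- A spanning tree is not properly contained in another one. -/
theorem IsSpanningTree.eq_of_subset {S T : Set E} (hS : IsSpanningTree H S)
    (hT : IsSpanningTree H T) (hST : S ⊆ T) : S = T := by
  refine hST.antisymm fun f hf => ?_
  by_contra hfS
  obtain ⟨C, -, -⟩ := hS.exists_directedCycle ⟨hT.1 hf, hfS⟩
  exact hT.2.2.false (C.transfer fun j =>
    (C.isLink j).mono (H.restrict_mono_right (Set.insert_subset hf hST)))

/-- Removing an edge from a spanning tree splits the vertices into two sides. -/
theorem exists_spanningTree_cut {T : Set E} (hT : IsSpanningTree H T) {e : E} {u v : V}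
    (heT : e ∈ T) (he : H.IsLink e u v) :
    ∃ X ⊆ V(H), u ∈ X ∧ v ∉ X ∧
      (∀ f ∈ T, f ≠ e → ∀ x y, H.IsLink f x y → (x ∈ X ↔ y ∈ X)) ∧
      (∀ x ∈ X, Relation.ReflTransGen (H.restrict (T \ {e})).Adj u x) ∧
      (∀ x ∈ V(H) \ X, Relation.ReflTransGen (H.restrict (T \ {e})).Adj v x) := by
  let K := H.restrict (T \ {e})
  let X : Set V := {x | x ∈ V(H) ∧ Relation.ReflTransGen K.Adj u x}
  have hX : ∀ f ∈ T, f ≠ e → ∀ x y, H.IsLink f x y → x ∈ X → y ∈ X := by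
    intro f hf hfe x y hxy hx
    exact ⟨hxy.right_mem, hx.2.tail ⟨f, by simpa using ⟨⟨hf, hfe⟩, hxy⟩⟩⟩
  have huX : u ∈ X := ⟨he.left_mem, .refl⟩
  have hvX : v ∉ X := by
    rintro ⟨-, h⟩
    obtain ⟨C, -, -⟩ := EdgeOrdering.exists_directedCycle (H := H.restrict T) (K := K) (e := e)
      (H.restrict_mono_right Set.sdiff_subset) h (by simpa [heT] using he.symm) (by simp [K])
    exact hT.2.2.false C
  refine ⟨X, fun x hx => hx.1, huX, hvX, ?_, fun x hx => hx.2, ?_⟩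
  · exact fun f hf hfe x y hxy => ⟨hX f hf hfe x y hxy, hX f hf hfe y x hxy.symm⟩
  · rintro x ⟨hx, hxX⟩
    -- Follow a walk of `T` from `v`: a step along `e` ends at `u` or `v`, and any other step stays
    -- on its side.
    have : x ∈ X ∨ Relation.ReflTransGen K.Adj v x := by
      clear hxX
      induction hT.2.1.2 v he.right_mem x hx with
      | refl => exact .inr .refl
      | @tail a b _ hab ih =>
        obtain ⟨f, hf, hab⟩ := hab
        by_cases hfe : f = e
        · subst hfe
          obtain ⟨-, rfl⟩ | ⟨rfl, -⟩ := he.eq_and_eq_or_eq_and_eq hab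
          · exact .inr .refl
          · exact .inl huX
        · obtain h | h := ih hab.left_mem
          · exact .inl (hX f hf hfe _ _ hab h)
          · exact .inr (h.tail ⟨f, by simpa using ⟨⟨hf, hfe⟩, hab⟩⟩)
    exact this.resolve_left hxX

/-- Part of a spanning tree that respects a vertex set and connects it is a spanning tree there. -/
theorem isSpanningTree_induce {T S : Set E} (hT : IsSpanningTree H T) (hST : S ⊆ T) {X : Set V}
    {q : V} (hq : q ∈ X)
    (hX : ∀ f ∈ S, ∀ x y, H.IsLink f x y → (x ∈ X ↔ y ∈ X))
    (hreach : ∀ x ∈ X, Relation.ReflTransGen (H.restrict S).Adj q x) :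
    IsSpanningTree (H.induce X) (S ∩ E(H.induce X)) := by
  refine ⟨Set.inter_subset_right, connected_of_root hq fun x hx => ?_, ⟨fun C => ?_⟩⟩
  · replace hx : x ∈ X := hx
    induction hreach x hx with
    | refl => exact .refl
    | @tail a b _ hab ih =>
      obtain ⟨f, hf, hab⟩ := hab
      have hb := hx
      have ha := (hX f hf _ _ hab).2 hb
      have hl : (H.induce X).IsLink f a b := ⟨hab, ha, hb⟩
      exact (ih ha).tail ⟨f, ⟨hf, hl.edge_mem⟩, hl⟩
  · exact hT.2.2.false (C.transfer fun j => ⟨hST (C.isLink j).1.1, (C.isLink j).2.1⟩)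

/-- Two spanning trees on complementary vertex sets and an edge joining them form a spanning
tree. -/
theorem isSpanningTree_glue {X : Set V} {S T : Set E} {e : E} {u v : V} (hX : X ⊆ V(H))
    (hS : IsSpanningTree (H.induce X) S) (hT : IsSpanningTree (H.induce (V(H) \ X)) T)
    (he : H.IsLink e u v) (hu : u ∈ X) (hv : v ∉ X) :
    IsSpanningTree H ({e} ∪ S ∪ T) := by
  have hSl : ∀ {f x y}, f ∈ S → H.IsLink f x y → x ∈ X ∧ y ∈ X := by
    intro f x y hf hxy
    have := ((Graph.induce_le hX).isLink_iff (hS.1 hf)).2 hxy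
    exact this.2
  have hTl : ∀ {f x y}, f ∈ T → H.IsLink f x y → x ∉ X ∧ y ∉ X := by
    intro f x y hf hxy
    have := ((Graph.induce_le Set.sdiff_subset).isLink_iff (hT.1 hf)).2 hxy
    exact ⟨this.2.1.2, this.2.2.2⟩
  refine ⟨?_, connected_of_root (q := u) he.left_mem fun x hx => ?_, ⟨fun C => ?_⟩⟩
  · refine Set.union_subset (Set.union_subset (by simpa using he.edge_mem) ?_) ?_
    · exact hS.1.trans (Graph.induce_le hX).edgeSet_mono
    · exact hT.1.trans (Graph.induce_le Set.sdiff_subset).edgeSet_mono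
  · by_cases hxX : x ∈ X
    · refine (hS.2.1.2 u hu x hxX).lift id ?_
      rintro a b ⟨f, hf, hab⟩
      exact ⟨f, .inl (.inr hf), hab.1⟩
    · refine .head (b := v) ⟨e, .inl (.inl rfl), he⟩ ?_
      refine (hT.2.1.2 v ⟨he.right_mem, hv⟩ x ⟨hx, hxX⟩).lift id ?_
      rintro a b ⟨f, hf, hab⟩
      exact ⟨f, .inr hf, hab.1⟩
  · have hne : ∀ f ∈ ({e} ∪ S ∪ T : Set E), f ≠ e → ∀ x y, H.IsLink f x y → (x ∈ X ↔ y ∈ X) := by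
      rintro f ((hf | hf) | hf) hfe x y hxy
      · exact absurd hf hfe
      · simp [hSl hf hxy]
      · simp [hTl hf hxy]
    -- Only `e` can cross `X`, and a cycle crossing `X` needs two different edges to do so.
    have hcross : ∀ j, C.vert j ∈ X ↔ C.vert (j + 1) ∈ X := by
      intro j
      by_contra hj
      obtain ⟨k, hk, hk'⟩ := C.exists_ne_crossing hj
      have hee : ∀ k, ¬ (C.vert k ∈ X ↔ C.vert (k + 1) ∈ X) → C.edge k = e := by
        intro k hk
        by_contra h
        exact hk (hne _ (C.isLink k).1 h _ _ (C.isLink k).2)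
      exact hk ((hee k hk').trans (hee j hj).symm)
    have hCe : ∀ j, C.edge j ≠ e := by
      intro j hj
      have h1 := (C.isLink j).2
      rw [hj] at h1
      have := hcross j
      obtain ⟨h2, h3⟩ | ⟨h2, h3⟩ := he.eq_and_eq_or_eq_and_eq h1 <;>
        rw [← h2, ← h3] at this <;> tauto
    by_cases h0 : C.vert 0 ∈ X
    · refine hS.2.2.false (C.transfer fun j => ?_)
      have hj := (C.vert_mem_iff hcross 0 j).1 h0
      have h1 := C.isLink j
      refine ⟨?_, h1.2, hj, (hcross j).1 hj⟩
      obtain (h | h) | h := h1.1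
      · exact absurd h (hCe j)
      · exact h
      · exact absurd hj (hTl h h1.2).1
    · refine hT.2.2.false (C.transfer fun j => ?_)
      have hj := fun h => h0 ((C.vert_mem_iff hcross 0 j).2 h)
      have h1 := C.isLink j
      refine ⟨?_, h1.2, ⟨h1.2.left_mem, hj⟩, ⟨h1.2.right_mem, fun h => hj ((hcross j).2 h)⟩⟩
      obtain (h | h) | h := h1.1
      · exact absurd h (hCe j)
      · exact absurd (hSl h h1.2).1 hj
      · exact h

/-! ### Rooted spanning trees -/

/-- Away from a root that reaches everything, one can choose for every vertex an incoming edge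
from a vertex nearer to the root. -/
theorem exists_parent {step : E → V → V → Prop} {q : V}
    (hreach : ∀ x ∈ V(H), Relation.ReflTransGen (fun a b => ∃ f, step f a b) q x) :
    ∃ (par : (V(H) \ {q} : Set V) → E) (r : V → ℕ),
      ∀ x, ∃ t, step (par x) t x ∧ r t < r x := by
  -- `S n` consists of the ends of walks with exactly `n` steps, so `r` below is the distance from
  -- `q`.
  let S : ℕ → Set V := fun n => Nat.rec {q} (fun _ s => {y | ∃ x ∈ s, ∃ f, step f x y}) n
  have hS : ∀ x, Relation.ReflTransGen (fun a b => ∃ f, step f a b) q x → ∃ n, x ∈ S n := by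
    intro x hx
    induction hx with
    | refl => exact ⟨0, rfl⟩
    | tail _ h ih =>
      obtain ⟨n, hn⟩ := ih
      exact ⟨n + 1, _, hn, h⟩
  let r : V → ℕ := fun x => sInf {n | x ∈ S n}
  have hpar : ∀ x : (V(H) \ {q} : Set V), ∃ f t, step f t x ∧ r t < r x := by
    rintro ⟨x, hx, hxq⟩
    have hr : x ∈ S (r x) := Nat.sInf_mem (s := {n | x ∈ S n}) (hS x (hreach x hx))
    rcases h : r x with _ | n
    · rw [h] at hr
      exact absurd hr hxq
    · rw [h] at hr
      obtain ⟨t, ht, f, hf⟩ := hr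
      exact ⟨f, t, hf, Nat.lt_succ_of_le (Nat.sInf_le ht)⟩
  choose par h using hpar
  exact ⟨par, r, h⟩

/-- The parent edges form a spanning tree. -/
theorem isSpanningTree_range_parent {q : V} (hq : q ∈ V(H)) {par : (V(H) \ {q} : Set V) → E}
    {r : V → ℕ} (h : ∀ x, ∃ t, H.IsLink (par x) t x ∧ r t < r x) :
    IsSpanningTree H (Set.range par) := by
  refine ⟨?_, connected_of_root hq fun x hx => ?_, ⟨fun C => ?_⟩⟩
  · rintro _ ⟨x, rfl⟩
    obtain ⟨t, ht, -⟩ := h x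
    exact ht.edge_mem
  · induction hn : r x using Nat.strong_induction_on generalizing x with
    | _ n ih =>
      by_cases hxq : x = q
      · rw [hxq]
      · obtain ⟨t, ht, hr⟩ := h ⟨x, hx, hxq⟩
        exact (ih _ (hn ▸ hr) t ht.left_mem rfl).tail ⟨_, ⟨_, rfl⟩, ht⟩
  · have : NeZero C.len := ⟨C.len_pos.ne'⟩
    -- At a vertex of maximal rank on the cycle, both incident cycle edges must be its own parent
    -- edge, contradicting their distinctness.
    obtain ⟨j, hj⟩ := Finite.exists_max fun j => r (C.vert j)
    have key : ∀ f y, f ∈ Set.range par → H.IsLink f (C.vert j) y → r y ≤ r (C.vert j) →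
        ∃ hm, f = par ⟨C.vert j, hm⟩ ∧ y ≠ C.vert j := by
      rintro _ y ⟨x, rfl⟩ hl hy
      obtain ⟨t, ht, hr⟩ := h x
      obtain ⟨h1, h2⟩ | ⟨h1, h2⟩ := hl.eq_and_eq_or_eq_and_eq ht
      · rw [h1, h2] at hy
        omega
      · refine ⟨h1 ▸ x.2, ?_, ?_⟩
        · congr 1
          exact Subtype.ext h1.symm
        · rintro rfl
          rw [h2] at h1
          rw [h1] at hr
          omega
    have h1 := C.isLink j
    have h2 := (C.isLink (j - 1)).symm
    rw [sub_add_cancel] at h2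
    obtain ⟨_, h3, -⟩ := key _ _ h1.1 h1.2 (hj _)
    obtain ⟨_, h4, h5⟩ := key _ _ h2.1 h2.2 (hj _)
    exact h5 (congrArg C.vert (C.edge_injective (h4.trans h3.symm)))

/-- If every vertex is reachable from `q` in an orientation, there is a spanning tree all of whose
edges are oriented away from `q`. -/
theorem exists_spanningTree_of_reachable {O : E → V} {q : V} (hq : q ∈ V(H))
    (h : ∀ x ∈ V(H), x ∈ reachable H O q) :
    ∃ T, IsSpanningTree H T ∧ Set.BijOn O T (V(H) \ {q}) := by
  obtain ⟨par, r, hr⟩ := exists_parent (step := fun f a b => H.IsLink f a b ∧ O f = b) h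
  have hO : ∀ x, O (par x) = x := fun x => (hr x).choose_spec.1.2
  refine ⟨Set.range par, isSpanningTree_range_parent hq (r := r) fun x => ?_, ?_, ?_, ?_⟩
  · obtain ⟨t, ht, htr⟩ := hr x
    exact ⟨t, ht.1, htr⟩
  · rintro _ ⟨x, rfl⟩
    rw [hO]
    exact x.2
  · rintro _ ⟨x, rfl⟩ _ ⟨y, rfl⟩ hxy
    rw [hO, hO] at hxy
    rw [Subtype.ext hxy]
  · exact fun x hx => ⟨_, ⟨⟨x, hx⟩, rfl⟩, hO _⟩

/-- A spanning tree can be oriented away from any vertex `q`. -/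
theorem IsSpanningTree.exists_rooted {T : Set E} (hT : IsSpanningTree H T) {q : V}
    (hq : q ∈ V(H)) :
    ∃ ρ : E → V, (∀ f ∈ T, H.Inc f (ρ f)) ∧ Set.BijOn ρ T (V(H) \ {q}) ∧
      ∀ x ∈ V(H), Relation.ReflTransGen (fun a b => ∃ f ∈ T, H.IsLink f a b ∧ ρ f = b) q x := by
  classical
  obtain ⟨par, r, hr⟩ := exists_parent (H := H) (step := (H.restrict T).IsLink)
    (fun x hx => hT.2.1.2 q hq x hx)
  -- The parent edges form a spanning tree inside `T`, hence all of `T`.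
  have hTr : Set.range par = T := by
    refine IsSpanningTree.eq_of_subset (isSpanningTree_range_parent hq (r := r) fun x => ?_) hT ?_
    · obtain ⟨t, ht, htr⟩ := hr x
      exact ⟨t, ht.2, htr⟩
    · rintro _ ⟨x, rfl⟩
      obtain ⟨t, ht, -⟩ := hr x
      exact ht.1
  -- An edge that is the parent edge of both its ends would make each end nearer to the root than
  -- the other.
  have hinj : Function.Injective par := by
    intro x y hxy
    obtain ⟨s, hs, hsr⟩ := hr x
    obtain ⟨t, ht, htr⟩ := hr y
    rw [hxy] at hs
    obtain ⟨-, h⟩ | ⟨h1, h2⟩ := hs.eq_and_eq_or_eq_and_eq ht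
    · exact Subtype.ext h
    · rw [h1] at hsr
      rw [← h2] at htr
      omega
  let ρ : E → V := fun f => if h : ∃ x, par x = f then h.choose else q
  have hρ : ∀ x, ρ (par x) = x := by
    intro x
    have h : ∃ y, par y = par x := ⟨x, rfl⟩
    simp only [ρ, dif_pos h]
    exact congrArg _ (hinj h.choose_spec)
  refine ⟨ρ, ?_, ⟨?_, ?_, ?_⟩, ?_⟩
  · rw [← hTr]
    rintro _ ⟨x, rfl⟩
    obtain ⟨t, ht, -⟩ := hr x
    rw [hρ]
    exact ht.2.inc_right
  · rw [← hTr]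
    rintro _ ⟨x, rfl⟩
    rw [hρ]
    exact x.2
  · rw [← hTr]
    rintro _ ⟨x, rfl⟩ _ ⟨y, rfl⟩ hxy
    rw [hρ, hρ] at hxy
    rw [Subtype.ext hxy]
  · rw [← hTr]
    exact fun x hx => ⟨_, ⟨⟨x, hx⟩, rfl⟩, hρ _⟩
  · intro x hx
    induction hn : r x using Nat.strong_induction_on generalizing x with
    | _ n ih =>
      by_cases hxq : x = q
      · rw [hxq]
      · obtain ⟨t, ht, htr⟩ := hr ⟨x, hx, hxq⟩
        exact (ih _ (hn ▸ htr) t ht.2.left_mem rfl).tail ⟨_, ht.1, ht.2, hρ _⟩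

/-! ### Break divisors as divisors of rooted orientations -/

theorem chip_apply (q x : V) [Decidable (x = q)] : chip q x = if x = q then 1 else 0 := by
  simp [chip, Set.indicator_apply]

/-- An ncard splits along a predicate. -/
theorem ncard_setOf_eq_add {s : Set E} (hs : s.Finite) (p : E → Prop) :
    s.ncard = (s ∩ {f | p f}).ncard + (s ∩ {f | ¬ p f}).ncard := by
  rw [← Set.ncard_union_eq _ (hs.inter_of_left _) (hs.inter_of_left _), ← Set.inter_union_distrib_left]
  · congr 1
    ext f
    simp [em]
  · exact Set.disjoint_left.2 fun f hf hf' => hf'.2 hf.2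

/-- The chips of an orientation that is directed away from `q` on a tree `T`, with one more chip
at `q`, count the heads of the edges outside `T`. -/
theorem orientationDivisor_add_chip (hE : E(H).Finite) {O : E → V} (hO : IsOrientation H O)
    {T : Set E} {q : V} (hT : T ⊆ E(H)) (hq : q ∈ V(H)) (hb : Set.BijOn O T (V(H) \ {q})) (x : V) :
    (orientationDivisor H O + chip q) x = ({f | f ∈ E(H) \ T ∧ O f = x}.ncard : ℤ) := by
  classical
  by_cases hx : x ∈ V(H)
  · have hfin : {f | f ∈ E(H) ∧ O f = x}.Finite := hE.subset fun f hf => hf.1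
    have h1 := ncard_setOf_eq_add hfin (· ∈ T)
    have h2 : {f | f ∈ E(H) ∧ O f = x} ∩ {f | f ∉ T} = {f | f ∈ E(H) \ T ∧ O f = x} := by
      ext f; simp; tauto
    -- Away from `q` one tree edge enters `x` and cancels the `-1`; at `q` none does, and the extra
    -- chip replaces it.
    have h3 : (({f | f ∈ E(H) ∧ O f = x} ∩ {f | f ∈ T}).ncard : ℤ) = 1 - chip q x := by
      rw [chip_apply]
      split_ifs with hxq
      · have : {f | f ∈ E(H) ∧ O f = x} ∩ {f | f ∈ T} = ∅ := by
          refine Set.eq_empty_of_forall_notMem fun f hf => ?_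
          exact (hb.1 hf.2).2 (hf.1.2.trans hxq)
        rw [this]
        simp
      · obtain ⟨f, hf, hfx⟩ := hb.2.2 ⟨hx, hxq⟩
        have : {f | f ∈ E(H) ∧ O f = x} ∩ {f | f ∈ T} = {f} := by
          ext g
          constructor
          · rintro ⟨⟨-, hg⟩, hgT⟩
            exact hb.2.1 hgT hf (hg.trans hfx.symm)
          · rintro rfl
            exact ⟨⟨hT hf, hfx⟩, hf⟩
        rw [this]
        simp
    rw [h2] at h1
    simp only [orientationDivisor, Pi.add_apply, Set.indicator_of_mem hx]
    rw [h1]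
    push_cast
    rw [h3]
    ring
  · have hxq : x ≠ q := fun h => hx (h ▸ hq)
    have : {f | f ∈ E(H) \ T ∧ O f = x} = ∅ := by
      refine Set.eq_empty_of_forall_notMem fun f hf => hx ?_
      rw [← hf.2]
      exact (hO f hf.1.1).vertex_mem
    rw [this]
    simp [orientationDivisor, hx, chip_apply, hxq]

/-- A break divisor comes from an orientation that reaches every vertex from `q`, which can be
chosen to extend given heads of the edges outside a spanning tree. -/
theorem exists_rooted_orientation (hE : E(H).Finite) {T : Set E} (hT : IsSpanningTree H T)
    {η : E → V} (hη : ∀ f ∈ E(H) \ T, H.Inc f (η f)) {D : V → ℤ}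
    (hD : ∀ x, D x = ({f | f ∈ E(H) \ T ∧ η f = x}.ncard : ℤ)) {q : V} (hq : q ∈ V(H)) :
    ∃ O, IsOrientation H O ∧ D = orientationDivisor H O + chip q ∧ (∀ f ∉ T, O f = η f) ∧
      ∀ x ∈ V(H), Relation.ReflTransGen (fun a b => ∃ f ∈ T, H.IsLink f a b ∧ O f = b) q x := by
  classical
  obtain ⟨ρ, h1, h2, h3⟩ := hT.exists_rooted hq
  let O : E → V := fun f => if f ∈ T then ρ f else η f
  have hOT : ∀ f ∈ T, O f = ρ f := fun f hf => if_pos hf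
  have hOη : ∀ f ∉ T, O f = η f := fun f hf => if_neg hf
  have hO : IsOrientation H O := by
    intro f hf
    by_cases hfT : f ∈ T
    · rw [hOT f hfT]
      exact h1 f hfT
    · rw [hOη f hfT]
      exact hη f ⟨hf, hfT⟩
  refine ⟨O, hO, ?_, hOη, ?_⟩
  · funext x
    rw [orientationDivisor_add_chip hE hO hT.1 hq (h2.congr fun f hf => (hOT f hf).symm), hD]
    congr 2
    ext f
    simp only [Set.mem_ofPred_eq]
    exact and_congr_right fun hf => by rw [hOη f hf.2]
  · intro x hx
    refine (h3 x hx).lift id ?_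
    rintro a b ⟨f, hf, hl, hb⟩
    exact ⟨f, hf, hl, (hOT f hf).trans hb⟩

/-- The root `q` is free, whichever tree witnesses the break divisor; this allows the root to be
placed at `v i` later. The converse is `isBreakDivisor_of_reachable`. -/
theorem IsBreakDivisor.exists_orientation (hE : E(H).Finite) {D : V → ℤ} (hD : IsBreakDivisor H D)
    {q : V} (hq : q ∈ V(H)) :
    ∃ O, IsOrientation H O ∧ D = orientationDivisor H O + chip q ∧
      ∀ x ∈ V(H), x ∈ reachable H O q := by
  obtain ⟨T, hT, η, hη, hD⟩ := hD
  obtain ⟨O, h1, h2, -, h3⟩ := exists_rooted_orientation hE hT hη hD hq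
  refine ⟨O, h1, h2, fun x hx => (h3 x hx).lift id ?_⟩
  rintro a b ⟨f, -, hf⟩
  exact ⟨f, hf⟩

/-- An orientation that reaches every vertex from `q` gives a break divisor. -/
theorem isBreakDivisor_of_reachable (hE : E(H).Finite) {O : E → V} (hO : IsOrientation H O) {q : V}
    (hq : q ∈ V(H)) (h : ∀ x ∈ V(H), x ∈ reachable H O q) :
    IsBreakDivisor H (orientationDivisor H O + chip q) := by
  obtain ⟨T, hT, hb⟩ := exists_spanningTree_of_reachable hq h
  exact ⟨T, hT, O, fun f hf => hO f hf.1, fun x => orientationDivisor_add_chip hE hO hT.1 hq hb x⟩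

theorem IsBreakDivisor.connected {D : V → ℤ} (hD : IsBreakDivisor H D) : Connected H :=
  let ⟨_, hT, _⟩ := hD
  hT.connected

/-! ### Reachable sets are determined by the divisor -/

theorem reachable_subset {O : E → V} {u : V} (hu : u ∈ V(H)) : reachable H O u ⊆ V(H) := by
  intro x hx
  induction hx with
  | refl => exact hu
  | tail _ h _ =>
    obtain ⟨f, hf, -⟩ := h
    exact hf.right_mem

/-- No edge is directed out of a set of reachable vertices. -/
theorem mem_reachable_of_isLink {O : E → V} {u a b : V} {f : E} (ha : a ∈ reachable H O u)
    (h : H.IsLink f a b) (hO : O f = b) : b ∈ reachable H O u :=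
  Relation.ReflTransGen.tail ha ⟨f, h, hO⟩

/-- Counting edges by their heads. -/
theorem ncard_head_mem (hE : E(H).Finite) (O : E → V) {W : Set V} (hW : W.Finite) :
    {f | f ∈ E(H) ∧ O f ∈ W}.ncard = ∑ x ∈ hW.toFinset, {f | f ∈ E(H) ∧ O f = x}.ncard := by
  classical
  have hfin : {f | f ∈ E(H) ∧ O f ∈ W}.Finite := hE.subset fun f hf => hf.1
  rw [Set.ncard_eq_toFinset_card _ hfin,
    Finset.card_eq_sum_card_fiberwise (f := O) (t := hW.toFinset) (by intro f; simp)]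
  refine Finset.sum_congr rfl fun x hx => ?_
  rw [← Set.ncard_coe_finset]
  congr 1
  ext f
  simp only [Set.Finite.mem_toFinset] at hx
  simp only [Finset.coe_filter, Set.Finite.mem_toFinset, Set.mem_ofPred_eq]
  constructor
  · exact fun h => ⟨h.1.1, h.2⟩
  · exact fun h => ⟨⟨h.1, h.2 ▸ hx⟩, h.2⟩

/-- Let `W` be the set that `O` does not reach. No edge enters `W` under `O`, so the edges with head
in `W` are just those inside `W`, the fewest possible. Equal divisors give `O'` the same number of
heads in `W`, so no edge enters `W` under `O'` either. -/
theorem reachable_subset_of_orientationDivisor_eq (hV : V(H).Finite) (hE : E(H).Finite)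
    {O O' : E → V} (hO : IsOrientation H O) (hO' : IsOrientation H O')
    (h : orientationDivisor H O = orientationDivisor H O') (u : V) :
    reachable H O' u ⊆ reachable H O u := by
  let W := V(H) \ reachable H O u
  have hW : W.Finite := hV.subset Set.sdiff_subset
  have hcard : {f | f ∈ E(H) ∧ O f ∈ W}.ncard = {f | f ∈ E(H) ∧ O' f ∈ W}.ncard := by
    rw [ncard_head_mem hE O hW, ncard_head_mem hE O' hW]
    refine Finset.sum_congr rfl fun x hx => ?_
    have hx : x ∈ W := by simpa using hx
    have := congrFun h x
    simp only [orientationDivisor, Set.indicator_of_mem hx.1] at this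
    omega
  have hin : ∀ f ∈ E(H), O f ∈ W → ∀ x, H.Inc f x → x ∈ W := by
    rintro f hf hfW x ⟨y, hxy⟩
    refine ⟨hxy.left_mem, fun hx => ?_⟩
    obtain h | h := (hO f hf).eq_or_eq_of_isLink hxy
    · exact hfW.2 (h ▸ hx)
    · exact hfW.2 (h ▸ mem_reachable_of_isLink hx hxy h)
  have hsub : {f | f ∈ E(H) ∧ O f ∈ W} ⊆ {f | f ∈ E(H) ∧ O' f ∈ W} :=
    fun f hf => ⟨hf.1, hin f hf.1 hf.2 _ (hO' f hf.1)⟩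
  have heq := Set.eq_of_subset_of_ncard_le hsub hcard.ge (hE.subset fun f hf => hf.1)
  intro x hx
  induction hx with
  | refl => exact .refl
  | @tail a b _ hab ih =>
    obtain ⟨f, hf, hb⟩ := hab
    by_contra hbr
    have : f ∈ {f | f ∈ E(H) ∧ O f ∈ W} := by
      rw [heq]
      exact ⟨hf.edge_mem, by rw [hb]; exact ⟨hf.right_mem, hbr⟩⟩
    exact (hin f this.1 this.2 a hf.inc_left).2 ih

/-- The reachable vertices depend only on the divisor of an orientation. -/
theorem reachable_eq_of_orientationDivisor_eq (hV : V(H).Finite) (hE : E(H).Finite)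
    {O O' : E → V} (hO : IsOrientation H O) (hO' : IsOrientation H O')
    (h : orientationDivisor H O = orientationDivisor H O') (u : V) :
    reachable H O u = reachable H O' u :=
  (reachable_subset_of_orientationDivisor_eq hV hE hO' hO h.symm u).antisymm
    (reachable_subset_of_orientationDivisor_eq hV hE hO hO' h u)

/-! ### Orientation divisors under deletion and cutting -/

/-- The number of edges other than `e` that cross `X` and end at `x ∈ X`. -/
noncomputable def cutDivisor (H : Graph V E) (X : Set V) (e : E) : V → ℤ :=
  X.indicator fun x => ({f | f ≠ e ∧ ∃ w ∉ X, H.IsLink f w x}.ncard : ℤ)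

theorem IsOrientation.mono {O : E → V} (hO : IsOrientation H O) (hKH : K ≤ H) :
    IsOrientation K O :=
  fun f hf => (hKH.inc_congr hf).2 (hO f (hKH.edgeSet_mono hf))

theorem orientationDivisor_deleteEdges (hE : E(H).Finite) {O : E → V} (hO : IsOrientation H O)
    {e : E} (he : e ∈ E(H)) :
    orientationDivisor H O = orientationDivisor (H.deleteEdges {e}) O + chip (O e) := by
  classical
  funext x
  by_cases hx : x ∈ V(H)
  · have hfin : {f | f ∈ E(H) ∧ O f = x}.Finite := hE.subset fun f hf => hf.1
    have h1 := ncard_setOf_eq_add hfin (· = e)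
    have h2 : {f | f ∈ E(H) ∧ O f = x} ∩ {f | ¬ f = e} =
        {f | f ∈ E(H.deleteEdges {e}) ∧ O f = x} := by
      ext f; simp; tauto
    have h3 : (({f | f ∈ E(H) ∧ O f = x} ∩ {f | f = e}).ncard : ℤ) = chip (O e) x := by
      rw [chip_apply]
      split_ifs with hxe
      · have : {f | f ∈ E(H) ∧ O f = x} ∩ {f | f = e} = {e} := by
          ext f
          constructor
          · exact fun h => h.2
          · rintro rfl
            exact ⟨⟨he, hxe.symm⟩, rfl⟩
        rw [this]
        simp
      · have : {f | f ∈ E(H) ∧ O f = x} ∩ {f | f = e} = ∅ := by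
          refine Set.eq_empty_of_forall_notMem ?_
          rintro f ⟨⟨-, hf⟩, rfl⟩
          exact hxe hf.symm
        rw [this]
        simp
    have hx' : x ∈ V(H.deleteEdges {e}) := hx
    simp only [orientationDivisor, Pi.add_apply, Set.indicator_of_mem hx,
      Set.indicator_of_mem hx']
    rw [h1, h2]
    push_cast
    rw [h3]
    ring
  · have hx' : x ∉ V(H.deleteEdges {e}) := hx
    have : x ≠ O e := fun h => hx (h ▸ (hO e he).vertex_mem)
    simp [orientationDivisor, hx, chip_apply, this]

/-- The divisor of an orientation all of whose edges crossing `X` are directed into `X`. -/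
theorem orientationDivisor_cut (hE : E(H).Finite) {O : E → V} (hO : IsOrientation H O) {X : Set V}
    (hX : X ⊆ V(H)) (hin : ∀ f a b, H.IsLink f a b → a ∈ X → O f = b → b ∈ X)
    {e : E} {u v : V} (he : H.IsLink e u v) (hu : u ∈ X) (hv : v ∉ X) :
    orientationDivisor H O = orientationDivisor (H.induce X) O + chip u +
      orientationDivisor (H.induce (V(H) \ X)) O + cutDivisor H X e := by
  classical
  have hhead : ∀ f a b, H.IsLink f a b → a ∉ X → b ∈ X → O f = b := by
    intro f a b hab ha hb
    obtain h | h := (hO f hab.edge_mem).eq_or_eq_of_isLink hab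
    · exact absurd (hin f b a hab.symm hb h) ha
    · exact h
  funext x
  simp only [orientationDivisor, cutDivisor, Pi.add_apply, chip_apply, Set.indicator_apply,
    Graph.vertexSet_induce, Set.mem_sdiff]
  by_cases hxX : x ∈ X
  · have hfin : {f | f ∈ E(H) ∧ O f = x}.Finite := hE.subset fun f hf => hf.1
    have h1 := ncard_setOf_eq_add hfin (· ∈ E(H.induce X))
    have h2 : {f | f ∈ E(H) ∧ O f = x} ∩ {f | f ∈ E(H.induce X)} =
        {f | f ∈ E(H.induce X) ∧ O f = x} := by
      ext f
      constructor
      · exact fun h => ⟨h.2, h.1.2⟩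
      · exact fun h => ⟨⟨(Graph.induce_le hX).edgeSet_mono h.1, h.2⟩, h.1⟩
    have h3 : {f | f ∈ E(H) ∧ O f = x} ∩ {f | f ∉ E(H.induce X)} =
        {f | ∃ w ∉ X, H.IsLink f w x} := by
      ext f
      constructor
      · rintro ⟨⟨hf, hfx⟩, hfX⟩
        obtain ⟨w, hw⟩ := hO f hf
        rw [hfx] at hw
        exact ⟨w, fun h => hfX ⟨x, w, hw, hxX, h⟩, hw.symm⟩
      · rintro ⟨w, hw, hl⟩
        refine ⟨⟨hl.edge_mem, hhead f w x hl hw hxX⟩, ?_⟩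
        rintro ⟨a, b, hab, ha, hb⟩
        obtain h | h := hl.left_eq_or_eq hab
        · exact hw (h ▸ ha)
        · exact hw (h ▸ hb)
    have h4 := ncard_setOf_eq_add (s := {f | ∃ w ∉ X, H.IsLink f w x})
      (hE.subset fun f ⟨w, _, h⟩ => h.edge_mem) (· = e)
    have h5 : {f | ∃ w ∉ X, H.IsLink f w x} ∩ {f | ¬ f = e} =
        {f | f ≠ e ∧ ∃ w ∉ X, H.IsLink f w x} := Set.inter_comm _ _
    -- Among the cut edges, `e` alone is split off: its chip at `u` becomes the root chip of the
    -- side `X`.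
    have h6 : ({f | ∃ w ∉ X, H.IsLink f w x} ∩ {f | f = e}).ncard = if x = u then 1 else 0 := by
      split_ifs with hxu
      · rw [Set.ncard_eq_one]
        refine ⟨e, Set.ext fun f => ⟨fun h => h.2, ?_⟩⟩
        rintro rfl
        exact ⟨⟨v, hv, hxu ▸ he.symm⟩, rfl⟩
      · have : {f | ∃ w ∉ X, H.IsLink f w x} ∩ {f | f = e} = ∅ := by
          refine Set.eq_empty_of_forall_notMem ?_
          rintro f ⟨⟨w, hw, hl⟩, rfl⟩
          obtain h | h := hl.right_eq_or_eq he
          · exact hxu h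
          · exact hv (h ▸ hxX)
        rw [this]
        simp
    rw [h2, h3, h4, h5, h6] at h1
    simp only [hX hxX, hxX, if_true, h1, not_true, and_false, if_false]
    push_cast
    ring
  · have hxu : x ≠ u := fun h => hxX (h ▸ hu)
    by_cases hxV : x ∈ V(H)
    · have : {f | f ∈ E(H) ∧ O f = x} = {f | f ∈ E(H.induce (V(H) \ X)) ∧ O f = x} := by
        ext f
        constructor
        · rintro ⟨hf, hfx⟩
          obtain ⟨w, hw⟩ := hO f hf
          rw [hfx] at hw
          have hwX : w ∉ X := fun h => hxX (hin f w x hw.symm h hfx)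
          exact ⟨⟨x, w, hw, ⟨hxV, hxX⟩, hw.right_mem, hwX⟩, hfx⟩
        · exact fun h => ⟨(Graph.induce_le Set.sdiff_subset).edgeSet_mono h.1, h.2⟩
      simp [hxV, hxX, hxu, this]
    · simp [hxX, hxV, hxu]

/-! ### Cycles of a tree plus an edge -/

/-- In the cycle of `T + f`, the edge `f` crosses a cut of `T` at `e` in the direction opposite to
that of `e`. -/
theorem DirectedCycle.cross_of_cut {T : Set E} {f e : E}
    (C : DirectedCycle (H.restrict (insert f T))) {X : Set V}
    (hX : ∀ g ∈ T, g ≠ e → ∀ x y, H.IsLink g x y → (x ∈ X ↔ y ∈ X)) {j k : ZMod C.len}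
    (hj : C.edge j = e) (hjX : C.vert j ∈ X) (hjX' : C.vert (j + 1) ∉ X) (hk : C.edge k = f) :
    C.vert k ∉ X ∧ C.vert (k + 1) ∈ X := by
  obtain ⟨l, hl, h1, h2⟩ := C.exists_enter hjX hjX'
  rw [hj] at hl
  have hlf : C.edge l = f := by
    refine (C.isLink l).1.resolve_right fun h => ?_
    exact h1 ((hX _ h hl _ _ (C.isLink l).2).2 h2)
  rw [C.edge_injective (hk.trans hlf.symm)]
  exact ⟨h1, h2⟩

/-- All cycles through `f` in `T + f` have the same edges. -/
theorem IsSpanningTree.range_edge_subset {T : Set E} (hT : IsSpanningTree H T) {f : E}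
    (C C' : DirectedCycle (H.restrict (insert f T))) (hf : f ∈ Set.range C.edge)
    (hf' : f ∈ Set.range C'.edge) : Set.range C.edge ⊆ Set.range C'.edge := by
  rintro _ ⟨j, rfl⟩
  obtain ⟨k, hk⟩ := hf
  obtain ⟨k', hk'⟩ := hf'
  by_cases hj : C.edge j = f
  · exact ⟨k', by rw [hk', hj]⟩
  -- Cut `T` at this edge of `C`. As `C` must return through `f`, the edge `f` crosses the cut; then
  -- `C'` crosses it a second time, which only the cut edge allows.
  obtain ⟨X, -, hu, hv, hX, -⟩ := exists_spanningTree_cut hT ((C.isLink j).1.resolve_left hj)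
    (C.isLink j).2
  obtain ⟨h1, h2⟩ := C.cross_of_cut hX rfl hu hv hk
  have h3 := (C.isLink k).2
  have h4 := (C'.isLink k').2
  rw [hk] at h3
  rw [hk'] at h4
  have h5 : ¬ (C'.vert k' ∈ X ↔ C'.vert (k' + 1) ∈ X) := by
    obtain ⟨h, h'⟩ | ⟨h, h'⟩ := h4.eq_and_eq_or_eq_and_eq h3 <;> rw [h, h'] <;> tauto
  obtain ⟨l, hl, hl'⟩ := C'.exists_ne_crossing h5
  rw [hk'] at hl
  refine ⟨l, ?_⟩
  by_contra hne
  exact hl' (hX _ ((C'.isLink l).1.resolve_left hl) hne _ _ (C'.isLink l).2)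

/-! ### The edge ordering map under deletion and cutting -/

namespace EdgeOrder

variable {data : EdgeOrder G}

theorem exists_isSmallest {S : Set E} (h : ∃ j, data.e j ∈ S) : ∃ i, data.IsSmallest S i := by
  have hne : {j | data.e j ∈ S}.Nonempty := h
  exact ⟨wellFounded_lt.min _ hne, wellFounded_lt.min_mem _ hne,
    fun j hj => not_lt.1 (wellFounded_lt.not_lt_min _ hj)⟩

theorem Orients.exists_isLink {T : Set E} {f : E} {x : V} (h : data.Orients H T f x) :
    ∃ y, H.IsLink f y x := by
  obtain ⟨C, -, k, hk, rfl⟩ := h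
  have hl := (C.isLink k).2
  rw [hk] at hl
  exact ⟨_, hl⟩

/-- A cycle without ordered edges would lie in the forest. So the cycle has a smallest ordered edge,
and reversing the cycle if necessary gives that edge its reference direction. -/
theorem exists_orients (hHG : H ≤ G) {T : Set E} (hT : IsSpanningTree H T) {f : E}
    (hf : f ∈ E(H) \ T) : ∃ x, data.Orients H T f x := by
  obtain ⟨C, k, hk⟩ := hT.exists_directedCycle hf
  have hlink : ∀ j, G.IsLink (C.edge j) (C.vert j) (C.vert (j + 1)) :=
    fun j => (C.isLink j).2.mono hHG
  have hne : ∃ j, data.e j ∈ Set.range C.edge := by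
    by_contra! h
    refine data.isForest.2.false (C.transfer fun j => ⟨?_, hlink j⟩)
    by_contra hj
    have : C.edge j ∈ Set.range data.e := by
      rw [data.range_e]
      exact ⟨(hlink j).edge_mem, hj⟩
    obtain ⟨i, hi⟩ := this
    exact h i ⟨j, hi.symm⟩
  obtain ⟨i, hi⟩ := exists_isSmallest hne
  obtain ⟨j, hj⟩ := hi.1
  have hl := hlink j
  rw [hj] at hl
  obtain ⟨h1, h2⟩ | ⟨h1, h2⟩ := hl.eq_and_eq_or_eq_and_eq (data.isLink i)
  · exact ⟨_, C, ⟨i, hi, j, hj, h1, h2⟩, k, hk, rfl⟩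
  · obtain ⟨j', hj1, hj2, hj3⟩ := C.exists_reverse_eq j
    obtain ⟨k', hk', -⟩ := C.exists_reverse_eq k
    exact ⟨_, C.reverse, ⟨i, C.range_reverse_edge ▸ hi, j', hj1.trans hj, hj2.trans h2,
      hj3.trans h1⟩, k', hk'.trans hk, rfl⟩

/-- Both cycles have the same edges, hence the same smallest edge. If it is not `f`, it is a tree
edge whose cut both cycles cross in the same direction, so both return through `f` in the same
direction. -/
theorem Orients.unique {T : Set E} (hT : IsSpanningTree H T) {f : E} {x y : V}
    (hx : data.Orients H T f x) (hy : data.Orients H T f y) : x = y := by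
  obtain ⟨C, ⟨i, hi, j, hj, hju, hjv⟩, k, hk, rfl⟩ := hx
  obtain ⟨C', ⟨i', hi', j', hj', hju', hjv'⟩, k', hk', rfl⟩ := hy
  have hr : Set.range C.edge = Set.range C'.edge :=
    (hT.range_edge_subset C C' ⟨k, hk⟩ ⟨k', hk'⟩).antisymm
      (hT.range_edge_subset C' C ⟨k', hk'⟩ ⟨k, hk⟩)
  rw [hr] at hi
  obtain rfl : i = i' := IsLeast.unique hi hi'
  by_cases hif : data.e i = f
  · rw [C.edge_injective (hk.trans (hif.symm.trans hj.symm)),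
      C'.edge_injective (hk'.trans (hif.symm.trans hj'.symm)), hjv, hjv']
  · have hl := C.isLink j
    rw [hj, hju, hjv] at hl
    obtain ⟨X, -, hu, hv, hX, -⟩ := exists_spanningTree_cut hT (hl.1.resolve_left hif) hl.2
    obtain ⟨h1, h2⟩ := C.cross_of_cut hX hj (hju ▸ hu) (hjv ▸ hv) hk
    obtain ⟨h1', h2'⟩ := C'.cross_of_cut hX hj' (hju' ▸ hu) (hjv' ▸ hv) hk'
    have h3 := (C.isLink k).2
    have h4 := (C'.isLink k').2
    rw [hk] at h3
    rw [hk'] at h4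
    obtain ⟨-, h⟩ | ⟨-, h⟩ := h3.eq_and_eq_or_eq_and_eq h4
    · exact h
    · exact absurd (h ▸ h2) h1'

theorem exists_heads (hHG : H ≤ G) {T : Set E} (hT : IsSpanningTree H T) :
    ∃ η : E → V, ∀ f ∈ E(H) \ T, data.Orients H T f (η f) := by
  have : Nonempty V := ⟨hT.2.1.1.choose⟩
  choose! η hη using fun f => exists_orients (data := data) (f := f) hHG hT
  exact ⟨η, hη⟩

/-- Uniqueness turns the relation `Orients` into a head function, the form used in break divisors.
-/
theorem edgeOrderingMap_apply {T : Set E} (hT : IsSpanningTree H T) {η : E → V}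
    (hη : ∀ f ∈ E(H) \ T, data.Orients H T f (η f)) (x : V) :
    data.edgeOrderingMap H T x = ({f | f ∈ E(H) \ T ∧ η f = x}.ncard : ℤ) := by
  rw [edgeOrderingMap]
  congr 2
  ext f
  refine and_congr_right fun hf => ⟨fun h => (hη f hf).unique hT h, ?_⟩
  rintro rfl
  exact hη f hf

theorem isBreakDivisor_edgeOrderingMap (hHG : H ≤ G) {T : Set E} (hT : IsSpanningTree H T) :
    IsBreakDivisor H (data.edgeOrderingMap H T) := by
  obtain ⟨η, hη⟩ := exists_heads (data := data) hHG hT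
  refine ⟨T, hT, η, fun f hf => ?_, edgeOrderingMap_apply hT hη⟩
  obtain ⟨y, hy⟩ := (hη f hf).exists_isLink
  exact hy.inc_right

/-- The smallest edge of `H` is oriented according to its reference orientation. -/
theorem Orients.eq_v {T : Set E} {i : Fin data.h} (hi : data.IsSmallest E(H) i) {x : V}
    (h : data.Orients H T (data.e i) x) : x = data.v i := by
  obtain ⟨C, ⟨i', hi', j, hj, hju, hjv⟩, k, hk, rfl⟩ := h
  obtain rfl : i = i' := by
    refine le_antisymm (hi.2 ?_) (hi'.2 ⟨k, hk⟩)
    change data.e i' ∈ E(H)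
    rw [← hj]
    exact (C.isLink j).2.edge_mem
  rw [C.edge_injective (hk.trans hj.symm), hjv]

theorem restrict_deleteEdges {T : Set E} {e : E} (he : e ∉ T) :
    (H.deleteEdges {e}).restrict T = H.restrict T := by
  refine Graph.ext rfl fun f x y => ?_
  simp only [Graph.restrict_isLink, Graph.deleteEdges_isLink, Set.mem_singleton_iff]
  refine and_congr_right fun hf => and_iff_left ?_
  rintro rfl
  exact he hf

theorem isSpanningTree_deleteEdges_iff {T : Set E} {e : E} (he : e ∉ T) :
    IsSpanningTree (H.deleteEdges {e}) T ↔ IsSpanningTree H T := by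
  rw [IsSpanningTree, IsSpanningTree, restrict_deleteEdges he]
  refine and_congr_left fun _ => ⟨fun h => h.trans Graph.deleteEdges_le.edgeSet_mono, ?_⟩
  intro h f hf
  refine ⟨h hf, ?_⟩
  rintro rfl
  exact he hf

/-- The cycle of any other edge `f` lives in `T + f` and avoids `e i`, so its head is unchanged. The
edge `e i` itself contributes the chip at `v i`. -/
theorem edgeOrderingMap_deleteEdges (hHG : H ≤ G) (hE : E(H).Finite) {T : Set E}
    (hT : IsSpanningTree H T) {i : Fin data.h} (hi : data.IsSmallest E(H) i) (hiT : data.e i ∉ T) :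
    data.edgeOrderingMap H T =
      data.edgeOrderingMap (H.deleteEdges {data.e i}) T + chip (data.v i) := by
  classical
  obtain ⟨η, hη⟩ := exists_heads (data := data) hHG hT
  have hη' : ∀ f ∈ E(H.deleteEdges {data.e i}) \ T,
      data.Orients (H.deleteEdges {data.e i}) T f (η f) := by
    intro f hf
    have h := hη f ⟨hf.1.1, hf.2⟩
    rw [Orients] at h ⊢
    rwa [restrict_deleteEdges]
    rintro (h | h)
    · exact hf.1.2 h.symm
    · exact hiT h
  have hv : η (data.e i) = data.v i := (hη _ ⟨hi.1, hiT⟩).eq_v hi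
  funext x
  rw [Pi.add_apply, edgeOrderingMap_apply hT hη,
    edgeOrderingMap_apply ((isSpanningTree_deleteEdges_iff hiT).2 hT) hη',
    ncard_setOf_eq_add (hE.subset fun f hf => hf.1.1) (· = data.e i)]
  have h2 : {f | f ∈ E(H) \ T ∧ η f = x} ∩ {f | ¬ f = data.e i} =
      {f | f ∈ E(H.deleteEdges {data.e i}) \ T ∧ η f = x} := by
    ext f; simp; tauto
  have h3 : (({f | f ∈ E(H) \ T ∧ η f = x} ∩ {f | f = data.e i}).ncard : ℤ) =
      chip (data.v i) x := by
    rw [chip_apply]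
    split_ifs with hx
    · have : {f | f ∈ E(H) \ T ∧ η f = x} ∩ {f | f = data.e i} = {data.e i} := by
        ext f
        constructor
        · exact fun h => h.2
        · rintro rfl
          exact ⟨⟨⟨hi.1, hiT⟩, hv.trans hx.symm⟩, rfl⟩
      rw [this]
      simp
    · have : {f | f ∈ E(H) \ T ∧ η f = x} ∩ {f | f = data.e i} = ∅ := by
        refine Set.eq_empty_of_forall_notMem ?_
        rintro f ⟨⟨-, hf⟩, rfl⟩
        exact hx (hf.symm.trans hv)
      rw [this]
      simp
  rw [h2]
  push_cast
  rw [h3]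
  ring

/-- A cycle in an induced subgraph orients its edges in the whole graph. -/
theorem Orients.of_induce {X : Set V} {S T : Set E} (hST : S ⊆ T) {f : E} {x : V}
    (h : data.Orients (H.induce X) S f x) : data.Orients H T f x := by
  obtain ⟨C, hC, hf⟩ := h
  exact ⟨C.transfer fun j => ⟨Set.insert_subset_insert hST (C.isLink j).1, (C.isLink j).2.1⟩,
    hC, hf⟩


/-- An edge crossing the cut of a spanning tree at the smallest edge `e i` is oriented against
`e i`. -/
theorem Orients.mem_of_cut {T : Set E} {X : Set V} {i : Fin data.h}
    (hi : data.IsSmallest E(H) i)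
    (hX : ∀ g ∈ T, g ≠ data.e i → ∀ x y, H.IsLink g x y → (x ∈ X ↔ y ∈ X))
    (hu : data.u i ∈ X) (hv : data.v i ∉ X) {f : E} {x y : V} (hf : H.IsLink f x y)
    (hxy : ¬ (x ∈ X ↔ y ∈ X)) (h : data.Orients H T f x) : x ∈ X := by
  obtain ⟨C, ⟨i', hi', j, hj, hju, hjv⟩, k, hk, rfl⟩ := h
  have hkl := (C.isLink k).2
  rw [hk] at hkl
  have hy : y = C.vert k := hf.right_unique hkl.symm
  -- The cycle of `f` crosses the cut a second time, necessarily along `e i`; being smallest in `H`,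
  -- this edge fixes the direction of the cycle.
  obtain ⟨l, hl, hl'⟩ := C.exists_ne_crossing (X := X) (j := k) (by rw [← hy]; tauto)
  rw [hk] at hl
  have hli : C.edge l = data.e i := by
    by_contra hne
    exact hl' (hX _ ((C.isLink l).1.resolve_left hl) hne _ _ (C.isLink l).2)
  obtain rfl : i = i' := by
    refine le_antisymm (hi.2 ?_) (hi'.2 ⟨l, hli⟩)
    change data.e i' ∈ E(H)
    rw [← hj]
    exact (C.isLink j).2.edge_mem
  exact (C.cross_of_cut hX hj (hju ▸ hu) (hjv ▸ hv) hk).2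

theorem edgeOrderingMap_of_notMem {T : Set E} {x : V} (hx : x ∉ V(H)) :
    data.edgeOrderingMap H T x = 0 := by
  have : {f | f ∈ E(H) \ T ∧ data.Orients H T f x} = ∅ := by
    refine Set.eq_empty_of_forall_notMem fun f hf => hx ?_
    obtain ⟨y, hy⟩ := hf.2.exists_isLink
    exact hy.right_mem
  rw [edgeOrderingMap, this]
  simp

/-- The edge ordering map of a spanning tree that contains the smallest edge `e i`, in terms of the
two sides of its cut at `e i`. -/
theorem edgeOrderingMap_cut (hHG : H ≤ G) (hE : E(H).Finite) {X : Set V} {S T : Set E}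
    (hX : X ⊆ V(H)) (hS : IsSpanningTree (H.induce X) S)
    (hT : IsSpanningTree (H.induce (V(H) \ X)) T) {i : Fin data.h}
    (hi : data.IsSmallest E(H) i) (hu : data.u i ∈ X) (hv : data.v i ∉ X) :
    data.edgeOrderingMap H ({data.e i} ∪ S ∪ T) = data.edgeOrderingMap (H.induce X) S +
      data.edgeOrderingMap (H.induce (V(H) \ X)) T + cutDivisor H X (data.e i) := by
  classical
  have hle := Graph.induce_le hX
  have hle' : H.induce (V(H) \ X) ≤ H := Graph.induce_le Set.sdiff_subset
  have he : H.IsLink (data.e i) (data.u i) (data.v i) :=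
    (hHG.isLink_iff hi.1).2 (data.isLink i)
  have hU := isSpanningTree_glue hX hS hT he hu hv
  have hin : ∀ {f x y}, H.IsLink f x y → f ∈ E(H.induce X) → x ∈ X ∧ y ∈ X :=
    fun h hf => ((hle.isLink_iff hf).2 h).2
  have hout : ∀ {f x y}, H.IsLink f x y → f ∈ E(H.induce (V(H) \ X)) → x ∉ X ∧ y ∉ X :=
    fun h hf => ⟨((hle'.isLink_iff hf).2 h).2.1.2, ((hle'.isLink_iff hf).2 h).2.2.2⟩
  have heX : data.e i ∉ E(H.induce X) := fun h => hv (hin he h).2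
  have heX' : data.e i ∉ E(H.induce (V(H) \ X)) := fun h => (hout he h).1 hu
  have hSX : ∀ {f x y}, H.IsLink f x y → x ∈ X → y ∈ X → f ∈ ({data.e i} ∪ S ∪ T : Set E) →
      f ∈ S := by
    rintro f x y h hx hy ((rfl | hf) | hf)
    · exact absurd ⟨x, y, h, hx, hy⟩ heX
    · exact hf
    · exact absurd hx (hout h (hT.1 hf)).1
  have hTX : ∀ {f x y}, H.IsLink f x y → x ∉ X → y ∉ X → f ∈ ({data.e i} ∪ S ∪ T : Set E) →
      f ∈ T := by
    rintro f x y h hx hy ((rfl | hf) | hf)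
    · exact absurd ⟨x, y, h, ⟨h.left_mem, hx⟩, h.right_mem, hy⟩ heX'
    · exact absurd (hin h (hS.1 hf)).1 hx
    · exact hf
  have hcut : ∀ g ∈ ({data.e i} ∪ S ∪ T : Set E), g ≠ data.e i →
      ∀ x y, H.IsLink g x y → (x ∈ X ↔ y ∈ X) := by
    rintro g ((hg | hg) | hg) hne x y h
    · exact absurd hg hne
    · simp [hin h (hS.1 hg)]
    · simp [hout h (hT.1 hg)]
  obtain ⟨η, hη⟩ := exists_heads (data := data) hHG hU
  obtain ⟨ηS, hηS⟩ := exists_heads (data := data) (hle.trans hHG) hS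
  obtain ⟨ηT, hηT⟩ := exists_heads (data := data) (hle'.trans hHG) hT
  have hmem : ∀ {f}, f ∈ E(H.induce X) \ S → f ∈ E(H) \ ({data.e i} ∪ S ∪ T) := by
    rintro f ⟨hf, hfS⟩
    obtain ⟨x, y, h, hx, hy⟩ := hf
    exact ⟨h.edge_mem, fun h' => hfS (hSX h hx hy h')⟩
  have hmem' : ∀ {f}, f ∈ E(H.induce (V(H) \ X)) \ T → f ∈ E(H) \ ({data.e i} ∪ S ∪ T) := by
    rintro f ⟨hf, hfT⟩
    obtain ⟨x, y, h, hx, hy⟩ := hf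
    exact ⟨h.edge_mem, fun h' => hfT (hTX h hx.2 hy.2 h')⟩
  -- The cycle of an edge inside one side also serves in the glued tree, so by uniqueness the heads
  -- agree.
  have hηS' : ∀ f ∈ E(H.induce X) \ S, data.Orients (H.induce X) S f (η f) := by
    intro f hf
    have := (hηS f hf).of_induce (T := {data.e i} ∪ S ∪ T) (fun f hf => .inl (.inr hf))
    rw [(hη f (hmem hf)).unique hU this]
    exact hηS f hf
  have hηT' : ∀ f ∈ E(H.induce (V(H) \ X)) \ T,
      data.Orients (H.induce (V(H) \ X)) T f (η f) := by
    intro f hf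
    have := (hηT f hf).of_induce (T := {data.e i} ∪ S ∪ T) (fun f hf => .inr hf)
    rw [(hη f (hmem' hf)).unique hU this]
    exact hηT f hf
  funext x
  simp only [Pi.add_apply]
  by_cases hx : x ∈ X
  · have hx' : x ∉ V(H.induce (V(H) \ X)) := fun h => h.2 hx
    rw [edgeOrderingMap_of_notMem hx', edgeOrderingMap_apply hU hη,
      edgeOrderingMap_apply hS hηS', cutDivisor, Set.indicator_of_mem hx,
      ncard_setOf_eq_add (hE.subset fun f hf => hf.1.1) (· ∈ E(H.induce X))]
    have h1 : {f | f ∈ E(H) \ ({data.e i} ∪ S ∪ T) ∧ η f = x} ∩ {f | f ∈ E(H.induce X)} =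
        {f | f ∈ E(H.induce X) \ S ∧ η f = x} := by
      ext f
      constructor
      · exact fun h => ⟨⟨h.2, fun h' => h.1.1.2 (.inl (.inr h'))⟩, h.1.2⟩
      · exact fun h => ⟨⟨hmem h.1, h.2⟩, h.1.1⟩
    -- Every crossing edge other than `e i` is outside the tree and has its head in `X`, by
    -- `Orients.mem_of_cut`.
    have h2 : {f | f ∈ E(H) \ ({data.e i} ∪ S ∪ T) ∧ η f = x} ∩ {f | f ∉ E(H.induce X)} =
        {f | f ≠ data.e i ∧ ∃ w ∉ X, H.IsLink f w x} := by
      ext f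
      constructor
      · rintro ⟨⟨hf, rfl⟩, hfX⟩
        obtain ⟨w, hw⟩ := (hη f hf).exists_isLink
        exact ⟨fun h => hf.2 (.inl (.inl h)), w, fun h => hfX ⟨w, _, hw, h, hx⟩, hw⟩
      · rintro ⟨hne, w, hwX, hw⟩
        have hf : f ∈ E(H) \ ({data.e i} ∪ S ∪ T) :=
          ⟨hw.edge_mem, fun h => hwX ((hcut f h hne w x hw).2 hx)⟩
        refine ⟨⟨hf, ?_⟩, fun h => hwX (hin hw h).1⟩
        obtain ⟨y, hy⟩ := (hη f hf).exists_isLink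
        obtain ⟨-, h⟩ | ⟨h1, h2⟩ := hy.eq_and_eq_or_eq_and_eq hw
        · exact h
        · have := (hη f hf).mem_of_cut hi hcut hu hv hy.symm (by rw [h1, h2]; tauto)
          exact absurd (h2 ▸ this) hwX
    rw [h1, h2]
    push_cast
    ring
  · have hx' : x ∉ V(H.induce X) := hx
    rw [edgeOrderingMap_of_notMem hx', edgeOrderingMap_apply hU hη,
      edgeOrderingMap_apply hT hηT', cutDivisor, Set.indicator_of_notMem hx, zero_add, add_zero]
    congr 2
    ext f
    constructor
    · rintro ⟨hf, rfl⟩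
      obtain ⟨w, hw⟩ := (hη f hf).exists_isLink
      have hwX : w ∉ X := by
        intro h
        exact hx ((hη f hf).mem_of_cut hi hcut hu hv hw.symm (by tauto))
      exact ⟨⟨⟨w, _, hw, ⟨hw.left_mem, hwX⟩, hw.right_mem, hx⟩, fun h => hf.2 (.inr h)⟩, rfl⟩
    · exact fun h => ⟨hmem' h.1, h.2⟩

end EdgeOrder

/-! ### Break divisors of the pieces, and recognizing the cut -/

/-- A directed path that uses `e` is back at its root `O e` and can restart there, so `e` is not
needed for reachability. The chip lost with `e` is the root chip of the smaller graph. -/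
theorem isBreakDivisor_deleteEdges (hE : E(H).Finite) {O : E → V} (hO : IsOrientation H O) {e : E}
    (he : e ∈ E(H)) (h : ∀ x ∈ V(H), x ∈ reachable H O (O e)) :
    IsBreakDivisor (H.deleteEdges {e}) (orientationDivisor H O) := by
  rw [orientationDivisor_deleteEdges hE hO he]
  refine isBreakDivisor_of_reachable (hE.subset Graph.deleteEdges_le.edgeSet_mono)
    (hO.mono Graph.deleteEdges_le) (hO e he).vertex_mem fun x hx => ?_
  induction h x hx with
  | refl => exact .refl
  | @tail a b _ hab ih =>
    obtain ⟨f, hf, hb⟩ := hab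
    by_cases hfe : f = e
    · rw [← hb, hfe]
      exact .refl
    · exact mem_reachable_of_isLink (f := f) (ih hf.left_mem) ⟨hf, hfe⟩ hb

/-- The part of an orientation on the vertices reachable from `u`. -/
theorem isBreakDivisor_induce_reachable (hE : E(H).Finite) {O : E → V} (hO : IsOrientation H O)
    {u : V} (hu : u ∈ V(H)) :
    IsBreakDivisor (H.induce (reachable H O u))
      (orientationDivisor (H.induce (reachable H O u)) O + chip u) := by
  have hle := Graph.induce_le (reachable_subset (O := O) hu)
  refine isBreakDivisor_of_reachable (hE.subset hle.edgeSet_mono) (hO.mono hle) .refl fun x hx => ?_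
  replace hx : x ∈ reachable H O u := hx
  induction hx with
  | refl => exact .refl
  | @tail a b ha hab ih =>
    obtain ⟨f, hf, hb⟩ := hab
    exact mem_reachable_of_isLink (f := f) ih ⟨hf, ha, mem_reachable_of_isLink ha hf hb⟩ hb

/-- The part of an orientation on the vertices not reachable from `u`. -/
theorem isBreakDivisor_induce_unreachable (hE : E(H).Finite) {O : E → V} (hO : IsOrientation H O)
    {u v : V} (hv : v ∈ V(H)) (hvu : v ∉ reachable H O u)
    (h : ∀ x ∈ V(H), x ∈ reachable H O v) :
    IsBreakDivisor (H.induce (V(H) \ reachable H O u))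
      (orientationDivisor (H.induce (V(H) \ reachable H O u)) O + chip v) := by
  have hle : H.induce (V(H) \ reachable H O u) ≤ H := Graph.induce_le Set.sdiff_subset
  refine isBreakDivisor_of_reachable (hE.subset hle.edgeSet_mono) (hO.mono hle) ⟨hv, hvu⟩
    fun x hx => ?_
  obtain ⟨hxV, hxu⟩ : x ∈ V(H) \ reachable H O u := hx
  induction h x hxV with
  | refl => exact .refl
  | @tail a b _ hab ih =>
    obtain ⟨f, hf, hb⟩ := hab
    -- A path ending outside the reachable set never visits it, since no edge is directed out of it.
    have ha : a ∉ reachable H O u := fun ha => hxu (mem_reachable_of_isLink ha hf hb)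
    exact mem_reachable_of_isLink (f := f) (ih hf.left_mem ha)
      ⟨hf, ⟨hf.left_mem, ha⟩, hf.right_mem, hxu⟩ hb

/-- In an orientation for which a spanning tree is directed away from `v` and all other edges
crossing the cut of the tree at `e = uv` point to the side of `u`, that side is exactly what can be
reached from `u`. -/
theorem reachable_eq_of_cut {O : E → V} {T : Set E} {X : Set V} {e : E} {u v : V}
    (hXV : X ⊆ V(H)) (he : H.IsLink e u v) (hu : u ∈ X) (hv : v ∉ X)
    (hX : ∀ f ∈ T, f ≠ e → ∀ x y, H.IsLink f x y → (x ∈ X ↔ y ∈ X))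
    (hT : ∀ x ∈ V(H),
      Relation.ReflTransGen (fun a b => ∃ f ∈ T, H.IsLink f a b ∧ O f = b) v x)
    (hO : ∀ f ∉ T, ∀ x y, H.IsLink f x y → O f = y → x ∈ X → y ∈ X) :
    reachable H O u = X := by
  have hcross : ∀ f ∈ T, ∀ a b, H.IsLink f a b → a ∉ X → b ∈ X → f = e ∧ b = u := by
    intro f hf a b hab ha hb
    have hfe : f = e := by
      by_contra hfe
      exact ha ((hX f hf hfe a b hab).2 hb)
    subst hfe
    obtain ⟨h1, -⟩ | ⟨h1, -⟩ := he.eq_and_eq_or_eq_and_eq hab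
    · exact absurd (h1 ▸ hu) ha
    · exact ⟨rfl, h1.symm⟩
  -- The tree path from `v` to `u` has to enter `X`, and only `e` lets it in.
  have hOe : O e = u := by
    have : u ∈ X → ∃ f ∈ T, ∃ a b, H.IsLink f a b ∧ O f = b ∧ a ∉ X ∧ b ∈ X := by
      have hreach := hT u he.left_mem
      clear he hcross hu
      induction hreach with
      | refl => exact fun h => absurd h hv
      | @tail a b _ hab ih =>
        obtain ⟨f, hf, hl, hb⟩ := hab
        intro hbX
        by_cases ha : a ∈ X
        · exact ih ha
        · exact ⟨f, hf, a, b, hl, hb, ha, hbX⟩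
    obtain ⟨f, hf, a, b, hl, hb, ha, hbX⟩ := this hu
    obtain ⟨rfl, rfl⟩ := hcross f hf a b hl ha hbX
    exact hb
  ext x
  constructor
  · intro hx
    induction hx with
    | refl => exact hu
    | @tail a b _ hab ih =>
      obtain ⟨f, hl, hb⟩ := hab
      by_cases hf : f ∈ T
      · by_cases hfe : f = e
        · rw [← hb, hfe, hOe]
          exact hu
        · exact (hX f hf hfe a b hl).1 ih
      · exact hO f hf a b hl hb ih
  · intro hx
    induction hT x (hXV hx) with
    | refl => exact absurd hx hv
    | @tail a b _ hab ih =>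
      obtain ⟨f, hf, hl, hb⟩ := hab
      by_cases ha : a ∈ X
      · exact mem_reachable_of_isLink (ih ha) hl hb
      · rw [(hcross f hf a b hl ha hx).2]
        exact .refl

/-! ### Surjectivity and the inverse algorithm -/

namespace EdgeOrder

variable {data : EdgeOrder G}

/-- An ordered edge is found on the cycle of `f`. Hence the algorithm does not get stuck on the
image of a tree: a nonzero image requires some edge outside `T`. -/
theorem exists_isSmallest_of_notMem (hHG : H ≤ G) {T : Set E} (hT : IsSpanningTree H T) {f : E}
    (hf : f ∈ E(H) \ T) : ∃ i, data.IsSmallest E(H) i := by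
  obtain ⟨x, C, ⟨i, hi, -⟩, -⟩ := exists_orients (data := data) hHG hT hf
  obtain ⟨j, hj⟩ := hi.1
  refine exists_isSmallest ⟨i, ?_⟩
  rw [← hj]
  exact (C.isLink j).2.edge_mem

theorem ncard_deleteEdges_lt (hE : E(H).Finite) {e : E} (he : e ∈ E(H)) :
    E(H.deleteEdges {e}).ncard < E(H).ncard :=
  Set.ncard_lt_ncard ⟨Graph.deleteEdges_le.edgeSet_mono, fun h => (h he).2 rfl⟩ hE

theorem ncard_induce_lt (hE : E(H).Finite) {X : Set V} (hX : X ⊆ V(H)) {e : E} {u v : V}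
    (he : H.IsLink e u v) (h : ¬ (u ∈ X ∧ v ∈ X)) : E(H.induce X).ncard < E(H).ncard := by
  have hle := Graph.induce_le hX
  exact Set.ncard_lt_ncard
    ⟨hle.edgeSet_mono, fun h' => h ((hle.isLink_iff (h' he.edge_mem)).2 he).2⟩ hE

/-- Every break divisor is the image of a spanning tree under the edge ordering map. -/
theorem exists_edgeOrderingMap_eq (data : EdgeOrder G) (hE : E(G).Finite) (hHG : H ≤ G) {D : V → ℤ}
    (hD : IsBreakDivisor H D) : ∃ T, IsSpanningTree H T ∧ data.edgeOrderingMap H T = D := by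
  induction hn : E(H).ncard using Nat.strong_induction_on generalizing H D with
  | _ n ih =>
    subst hn
    have hEH : E(H).Finite := hE.subset hHG.edgeSet_mono
    obtain ⟨T₀, hT₀, η, hη, hDη⟩ := id hD
    by_cases hne : (E(H) \ T₀).Nonempty
    swap
    · rw [Set.not_nonempty_iff_eq_empty] at hne
      refine ⟨T₀, hT₀, funext fun x => ?_⟩
      rw [hDη, edgeOrderingMap, hne]
      simp
    obtain ⟨f, hf⟩ := hne
    obtain ⟨i, hi⟩ := exists_isSmallest_of_notMem (data := data) hHG hT₀ hf
    have he : H.IsLink (data.e i) (data.u i) (data.v i) := (hHG.isLink_iff hi.1).2 (data.isLink i)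
    obtain ⟨O, hO, hDO, hreach⟩ := hD.exists_orientation hEH he.right_mem
    by_cases hv : data.v i ∈ reachable H O (data.u i)
    -- If `u i` reaches `v i`, both ends of `e i` reach everything, so its head under `O` may serve
    -- as root, whichever end it is.
    · have hb : IsBreakDivisor (H.deleteEdges {data.e i}) (orientationDivisor H O) := by
        refine isBreakDivisor_deleteEdges hEH hO hi.1 fun x hx => ?_
        obtain h | h := (hO _ hi.1).eq_or_eq_of_isLink he <;> rw [h]
        · exact Relation.ReflTransGen.trans hv (hreach x hx)
        · exact hreach x hx
      obtain ⟨T, hT, hTD⟩ := ih _ (ncard_deleteEdges_lt hEH hi.1)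
        (Graph.deleteEdges_le.trans hHG) hb rfl
      have heT : data.e i ∉ T := fun h => (hT.1 h).2 rfl
      have hT' := (isSpanningTree_deleteEdges_iff heT).1 hT
      exact ⟨T, hT', by rw [edgeOrderingMap_deleteEdges hHG hEH hT' hi heT, hTD, hDO]⟩
    · have hX := reachable_subset (O := O) he.left_mem
      have hu : data.u i ∈ reachable H O (data.u i) := .refl
      -- The reachable side is rooted at `u i`, with root chip supplied by `e i`; the other side is
      -- rooted at `v i` and keeps the root chip of `D`.
      obtain ⟨S, hS, hSD⟩ := ih _ (ncard_induce_lt hEH hX he fun h => hv h.2)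
        ((Graph.induce_le hX).trans hHG) (isBreakDivisor_induce_reachable hEH hO he.left_mem) rfl
      obtain ⟨T, hT, hTD⟩ := ih _ (ncard_induce_lt hEH Set.sdiff_subset he fun h => h.1.2 hu)
        ((Graph.induce_le Set.sdiff_subset).trans hHG)
        (isBreakDivisor_induce_unreachable hEH hO he.right_mem hv hreach) rfl
      refine ⟨_, isSpanningTree_glue hX hS hT he hu hv, ?_⟩
      rw [edgeOrderingMap_cut hHG hEH hX hS hT hi hu hv, hSD, hTD, hDO,
        orientationDivisor_cut hEH hO hX
          (fun f a b hl ha hb => mem_reachable_of_isLink ha hl hb) he hu hv]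
      abel

variable {sub : Graph V E → (V → ℤ) → V → (E → V)}

theorem inverse_succ_of_mem {D : V → ℤ} (hD : D ≠ 0) {i : Fin data.h}
    (hi : data.IsSmallest E(H) i)
    (hv : data.v i ∈ reachable H (sub H D (data.v i)) (data.u i)) (n : ℕ) :
    data.inverse sub (n + 1) H D =
      data.inverse sub n (H.deleteEdges {data.e i}) (D - chip (data.v i)) := by
  have h : ∃ i, data.IsSmallest E(H) i := ⟨i, hi⟩
  have hc : h.choose = i := IsLeast.unique h.choose_spec hi
  rw [inverse, if_neg hD, dif_pos h]
  exact (if_pos (by rwa [hc])).trans (by simp only [hc])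

theorem inverse_succ_of_notMem {D : V → ℤ} (hD : D ≠ 0) {i : Fin data.h}
    (hi : data.IsSmallest E(H) i) {O : E → V} (hO : sub H D (data.v i) = O) {U : Set V}
    (hU : reachable H O (data.u i) = U) (hv : data.v i ∉ U) (n : ℕ) :
    data.inverse sub (n + 1) H D =
      (data.inverse sub n (H.induce U) (U.indicator fun x =>
        D x - ({f | f ≠ data.e i ∧ ∃ w ∉ U, H.IsLink f w x ∧ O f = x}.ncard : ℤ))).bind
      fun TL => (data.inverse sub n (H.induce (V(H) \ U)) ((V(H) \ U).indicator D)).map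
        fun TR => {data.e i} ∪ TL ∪ TR := by
  have h : ∃ i, data.IsSmallest E(H) i := ⟨i, hi⟩
  have hc : h.choose = i := IsLeast.unique h.choose_spec hi
  subst hO hU
  rw [inverse, if_neg hD, dif_pos h]
  exact (if_neg (by rwa [hc])).trans (by simp only [hc])

/-- The inverse algorithm recovers a spanning tree from its image. -/
theorem outputs_edgeOrderingMap (hV : V(G).Finite) (hE : E(G).Finite)
    (hsub : IsDivisorToOrientation G sub) (hHG : H ≤ G) {T : Set E} (hT : IsSpanningTree H T) :
    data.Outputs sub H (data.edgeOrderingMap H T) T := by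
  induction hn : E(H).ncard using Nat.strong_induction_on generalizing H T with
  | _ n ih =>
    subst hn
    have hEH : E(H).Finite := hE.subset hHG.edgeSet_mono
    have hVH : V(H).Finite := hV.subset hHG.vertexSet_mono
    obtain ⟨η, hη⟩ := exists_heads (data := data) hHG hT
    have hDη := edgeOrderingMap_apply hT hη
    have hbreak := isBreakDivisor_edgeOrderingMap (data := data) hHG hT
    by_cases hD : data.edgeOrderingMap H T = 0
    · have hTE : E(H) = T := by
        refine Set.Subset.antisymm (fun f hf => ?_) hT.1
        by_contra hfT
        have h0 := hDη (η f)
        rw [hD, Pi.zero_apply, eq_comm, Int.natCast_eq_zero,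
          Set.ncard_eq_zero (hEH.subset fun f hf => hf.1.1)] at h0
        exact Set.eq_empty_iff_forall_notMem.1 h0 f ⟨⟨hf, hfT⟩, rfl⟩
      refine ⟨1, fun n hn => ?_⟩
      obtain ⟨n, rfl⟩ : ∃ m, n = m + 1 := ⟨n - 1, by omega⟩
      rw [inverse, if_pos hD, hTE]
    have hne : (E(H) \ T).Nonempty := by
      by_contra hne
      rw [Set.not_nonempty_iff_eq_empty] at hne
      refine hD (funext fun x => ?_)
      rw [hDη, hne]
      simp
    obtain ⟨f, hf⟩ := hne
    obtain ⟨i, hi⟩ := exists_isSmallest_of_notMem (data := data) hHG hT hf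
    have he : H.IsLink (data.e i) (data.u i) (data.v i) := (hHG.isLink_iff hi.1).2 (data.isLink i)
    -- `O'` directs `T` away from `v i` and the other edges as the edge ordering map does. The
    -- subroutine may return a different `O`, but the two divisors agree, hence so do the reachable
    -- sets.
    obtain ⟨O', hO', hDO', hOη, hreach⟩ := exists_rooted_orientation hEH hT
      (fun f hf => (hη f hf).exists_isLink.choose_spec.inc_right) hDη he.right_mem
    obtain ⟨hO, hDO⟩ := hsub H hHG hT.connected _ hbreak _ he.right_mem
    generalize hOs : sub H (data.edgeOrderingMap H T) (data.v i) = O at hO hDO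
    have hU : reachable H O (data.u i) = reachable H O' (data.u i) :=
      reachable_eq_of_orientationDivisor_eq hVH hEH hO hO'
        (add_right_cancel (hDO.symm.trans hDO')) _
    by_cases heT : data.e i ∈ T
    · obtain ⟨X, hXV, hu, hv, hX, hXr, hYr⟩ := exists_spanningTree_cut hT heT he
      have hUX : reachable H O (data.u i) = X := by
        rw [hU]
        refine reachable_eq_of_cut hXV he hu hv hX hreach fun f hfT x y hl hy hx => ?_
        by_contra hyX
        have hyη := hη f ⟨hl.edge_mem, hfT⟩
        rw [← hOη f hfT, hy] at hyη
        exact hyX (hyη.mem_of_cut hi hX hu hv hl.symm (by tauto))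
      have hle := Graph.induce_le hXV
      have hle' : H.induce (V(H) \ X) ≤ H := Graph.induce_le Set.sdiff_subset
      have hS := isSpanningTree_induce hT (S := T \ {data.e i}) Set.sdiff_subset hu
        (fun f hf => hX f hf.1 hf.2) hXr
      have hR := isSpanningTree_induce hT (S := T \ {data.e i}) (X := V(H) \ X) Set.sdiff_subset
        ⟨he.right_mem, hv⟩ (fun f hf x y hl => by
          simp [hl.left_mem, hl.right_mem, hX f hf.1 hf.2 x y hl]) hYr
      obtain ⟨N₁, hN₁⟩ := ih _ (ncard_induce_lt hEH hXV he fun h => hv h.2) (hle.trans hHG) hS rfl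
      obtain ⟨N₂, hN₂⟩ := ih _ (ncard_induce_lt hEH Set.sdiff_subset he fun h => h.1.2 hu)
        (hle'.trans hHG) hR rfl
      have hTeq := (isSpanningTree_glue hXV hS hR he hu hv).eq_of_subset hT (by
        rintro f ((rfl | hf) | hf)
        · exact heT
        · exact hf.1.1
        · exact hf.1.1)
      have hcut := edgeOrderingMap_cut hHG hEH hXV hS hR hi hu hv
      rw [hTeq] at hcut
      -- One level of depth is spent here, and both recursive calls share what remains.
      refine ⟨max N₁ N₂ + 1, fun n hn => ?_⟩
      obtain ⟨n, rfl⟩ : ∃ m, n = m + 1 := ⟨n - 1, by omega⟩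
      rw [inverse_succ_of_notMem hD hi hOs hUX hv]
      have hDL : (X.indicator fun x => data.edgeOrderingMap H T x -
          ({f | f ≠ data.e i ∧ ∃ w ∉ X, H.IsLink f w x ∧ O f = x}.ncard : ℤ)) =
          data.edgeOrderingMap (H.induce X) (T \ {data.e i} ∩ E(H.induce X)) := by
        funext x
        by_cases hx : x ∈ X
        -- `X` is reachable under `O`, so every crossing edge already points into it and the
        -- direction condition is automatic.
        · have hset : {f | f ≠ data.e i ∧ ∃ w ∉ X, H.IsLink f w x ∧ O f = x} =
              {f | f ≠ data.e i ∧ ∃ w ∉ X, H.IsLink f w x} := by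
            ext f
            refine and_congr_right fun _ => exists_congr fun w => and_congr_right fun hw =>
              and_iff_left_of_imp fun hl => ?_
            refine ((hO f hl.edge_mem).eq_or_eq_of_isLink hl).resolve_left fun h => hw ?_
            rw [← hUX] at hx ⊢
            exact mem_reachable_of_isLink hx hl.symm h
          rw [Set.indicator_of_mem hx, hcut, hset, Pi.add_apply, Pi.add_apply, cutDivisor,
            Set.indicator_of_mem hx,
            edgeOrderingMap_of_notMem (H := H.induce (V(H) \ X)) fun h => h.2 hx]
          ring
        · rw [Set.indicator_of_notMem hx, edgeOrderingMap_of_notMem (H := H.induce X) hx]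
      have hDR : (V(H) \ X).indicator (data.edgeOrderingMap H T) =
          data.edgeOrderingMap (H.induce (V(H) \ X))
            (T \ {data.e i} ∩ E(H.induce (V(H) \ X))) := by
        funext x
        by_cases hx : x ∈ V(H) \ X
        · rw [Set.indicator_of_mem hx, hcut, Pi.add_apply, Pi.add_apply, cutDivisor,
            Set.indicator_of_notMem hx.2, edgeOrderingMap_of_notMem (H := H.induce X) hx.2]
          ring
        · rw [Set.indicator_of_notMem hx,
            edgeOrderingMap_of_notMem (H := H.induce (V(H) \ X)) hx]
      rw [hDL, hDR, hN₁ n (by omega), hN₂ n (by omega)]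
      simp only [Option.bind_some, Option.map_some, hTeq]
    · have hv : data.v i ∈ reachable H (sub H (data.edgeOrderingMap H T) (data.v i))
          (data.u i) := by
        rw [hOs, hU]
        -- Outside `T`, the edge `e i` keeps its reference direction in `O'`, so `v i` is one step
        -- from `u i`.
        refine mem_reachable_of_isLink .refl he ?_
        rw [hOη _ heT]
        exact (hη _ ⟨hi.1, heT⟩).eq_v hi
      obtain ⟨N, hN⟩ := ih _ (ncard_deleteEdges_lt hEH hi.1) (Graph.deleteEdges_le.trans hHG)
        ((isSpanningTree_deleteEdges_iff heT).2 hT) rfl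
      refine ⟨N + 1, fun n hn => ?_⟩
      obtain ⟨n, rfl⟩ : ∃ m, n = m + 1 := ⟨n - 1, by omega⟩
      rw [inverse_succ_of_mem hD hi hv, edgeOrderingMap_deleteEdges hHG hEH hT hi heT,
        add_sub_cancel_right]
      exact hN n (by omega)

theorem Outputs.unique {D : V → ℤ} {S T : Set E} (hS : data.Outputs sub H D S)
    (hT : data.Outputs sub H D T) : S = T := by
  obtain ⟨M, hM⟩ := hS
  obtain ⟨N, hN⟩ := hT
  have h := (hM _ (le_max_left M N)).symm.trans (hN _ (le_max_right M N))
  exact Option.some.inj h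

end EdgeOrder

/-! ### Existence of the subroutine and the main theorem -/

/-- A divisor-to-orientation subroutine exists. -/
theorem exists_isDivisorToOrientation (hE : E(G).Finite) :
    ∃ sub, IsDivisorToOrientation G sub := by
  have h : ∀ (H : Graph V E) (D : V → ℤ) (q : V), ∃ O : E → V, H ≤ G → IsBreakDivisor H D →
      q ∈ V(H) → IsOrientation H O ∧ D = orientationDivisor H O + chip q := by
    intro H D q
    by_cases hH : H ≤ G ∧ IsBreakDivisor H D ∧ q ∈ V(H)
    · obtain ⟨h1, h2, h3⟩ := hH
      obtain ⟨O, hO, hD, -⟩ := h2.exists_orientation (hE.subset h1.edgeSet_mono) h3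
      exact ⟨O, fun _ _ _ => ⟨hO, hD⟩⟩
    -- On invalid inputs any value will do.
    · exact ⟨fun _ => q, fun h1 h2 h3 => absurd ⟨h1, h2, h3⟩ hH⟩
  choose sub hsub using h
  exact ⟨sub, fun H hH _ D hD q hq => hsub H D q hH hD hq⟩

end EdgeOrdering

theorem mainTheorem6 {V E : Type*} (G : Graph V E) [G.Loopless]
    (hV : V(G).Finite) (hE : E(G).Finite) (data : EdgeOrdering.EdgeOrder G) :
    (∃ sub, EdgeOrdering.IsDivisorToOrientation G sub) ∧
    (∀ sub, EdgeOrdering.IsDivisorToOrientation G sub →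
      ∀ H ≤ G, EdgeOrdering.Connected H →
        (∀ D, EdgeOrdering.IsBreakDivisor H D →
          ∃ T, data.Outputs sub H D T ∧ EdgeOrdering.IsSpanningTree H T ∧
            data.edgeOrderingMap H T = D) ∧
        (∀ T, EdgeOrdering.IsSpanningTree H T →
          EdgeOrdering.IsBreakDivisor H (data.edgeOrderingMap H T) ∧
            data.Outputs sub H (data.edgeOrderingMap H T) T)) ∧
    (∀ H ≤ G, EdgeOrdering.Connected H →
      Set.BijOn (data.edgeOrderingMap H) {T | EdgeOrdering.IsSpanningTree H T}
        {D | EdgeOrdering.IsBreakDivisor H D}) := by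
  obtain ⟨sub₀, hsub₀⟩ := EdgeOrdering.exists_isDivisorToOrientation hE
  refine ⟨⟨sub₀, hsub₀⟩, fun sub hsub H hHG _ => ⟨fun D hD => ?_, fun T hT => ⟨?_, ?_⟩⟩,
    fun H hHG _ => ⟨fun T hT => ?_, fun S hS T hT h => ?_, fun D hD => ?_⟩⟩
  · obtain ⟨T, hT, rfl⟩ := data.exists_edgeOrderingMap_eq hE hHG hD
    exact ⟨T, EdgeOrdering.EdgeOrder.outputs_edgeOrderingMap hV hE hsub hHG hT, hT, rfl⟩
  · exact EdgeOrdering.EdgeOrder.isBreakDivisor_edgeOrderingMap hHG hT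
  · exact EdgeOrdering.EdgeOrder.outputs_edgeOrderingMap hV hE hsub hHG hT
  · exact EdgeOrdering.EdgeOrder.isBreakDivisor_edgeOrderingMap hHG hT
  -- Trees with the same image are both the output of one run of the algorithm, hence equal.
  · have hS' := EdgeOrdering.EdgeOrder.outputs_edgeOrderingMap (data := data) hV hE hsub₀ hHG hS
    have hT' := EdgeOrdering.EdgeOrder.outputs_edgeOrderingMap (data := data) hV hE hsub₀ hHG hT
    exact EdgeOrdering.EdgeOrder.Outputs.unique (h ▸ hS') hT'
  · exact data.exists_edgeOrderingMap_eq hE hHG hD
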